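/- Let $d\ge 1$ and let $M$ be an integer $d\times d$ matrix with $m=|\det M|\ge 2$, all of whose (complex) eigenvalues are bigger than $1$ in absolute value. Let $D\subset\mathbb Z^d$ be a set of digits for $M$, i.e. $\mathbf 0\in D$, $D$ has $m$ elements, and no two distinct elements of $D$ differ by an element of $M\mathbb Z^d$; let $D^*$ be a set of digits for the transpose $M^*$ of $M$. Let $\mu$ be Lebesgue measure on $\mathbb R^d$. Let $X^+$ be the set of all $x\in\mathbb R^d$ of the form $x=\sum_{j\in\mathbb Z}M^{-j}x_j$ with $x_j\in D$ and only finitely many nonzero $x_j$ with $j<0$, and let $X^0$ be the set of those $x\in X^+$ that have such an expansion with only finitely many nonzero $x_j$. Let $\widetilde U$ be the set of vectors that have two expansions $\sum_{j\ge1}M^{-j}u_j=\sum_{j\ge 1}M^{-j}u_j'$ with $u_j,u_j'\in D$ and $u_1\ne u_1'$. Put $$\widetilde X=\bigcup_{h\in X^0}\bigcup_{n\in\mathbb Z}M^n(\widetilde U+h),\qquad X=X(M,D)=(X^+\setminus\widetilde X)\cup X^0 .$$ The digits $x_j$ of $x\in X$ are those of its finite expansion if $x\in X^0$, and those of its only expansion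 otherwise. Let $U=\{x\in X: x_j=\mathbf 0\text{ for all }j\le 0\}$. Let $X^*$, $U^*$ and the digits $\omega_j\in D^*$ of $\omega\in X^*$ be defined in the same way from $(M^*,D^*)$. For $x\in X$, $\omega\in X^*$ put $$\chi(x,\omega)=\exp\Big(2\pi i\sum_{j\in\mathbb Z}\langle M^{-1}x_j,\omega_{1-j}\rangle\Big)$$ (a sum with finitely many nonzero terms). For $f\in L^2(X)$ (complex-valued), $l=0,1,2,\dots$ and $\omega\in X^*$ put $$J_lf(\omega)=\frac1{\mu(U)}\int_{M^l(U)}f(x)\overline{\chi(x,\omega)}\,d\mu(x).$$ Theorem (Plancherel). The numbers $\mu(U)$ and $\mu(U^*)$ are positive and finite. For every $f\in L^2(X)$ the integrals defining $J_lf(\omega)$ converge absolutely for all $l\ge 0$ and $\omega\in X^*$, the functions $J_lf$ belong to $L^2(X^*)$, and they converge in $L^2(X^*)$, as $l\to\infty$, to a function $\widehat f\in L^2(X^*)$, the Fourier transform of $f$. If $f\in L^1(X)\cap L^2(X)$, then $\widehat f(\omega)=\frac1{\mu(U)}\int_X f(x)\overline{\chi(x,\omega)}\,d\mu(x)$ for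 almost every $\omega\in X^*$. Moreover, for every $f\in L^2(X)$, $$\frac1{\mu(U)}\int_X|f(x)|^2\,d\mu(x)=\frac1{\mu(U^*)}\int_{X^*}|\widehat f(\omega)|^2\,d\mu(\omega),$$ and for all $f,g\in L^2(X)$, $$\frac1{\mu(U)}\int_Xf(x)\overline{g(x)}\,d\mu(x)=\frac1{\mu(U^*)}\int_{X^*}\widehat f(\omega)\overline{\widehat g(\omega)}\,d\mu(\omega).$$ -/

import Mathlib

open MeasureTheory Filter Topology
open scoped Matrix ENNReal

noncomputable section

namespace MPositive

variable {d : ℕ}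

/-- All (complex) eigenvalues of the integer matrix `M` are bigger than `1` in absolute value. -/
def IsDilation (M : Matrix (Fin d) (Fin d) ℤ) : Prop :=
  ∀ z ∈ spectrum ℂ (M.map (fun a : ℤ => (a : ℂ))), 1 < ‖z‖

/-- `D` is a set of digits for `M`: it consists of `|det M|` integer vectors, contains `0`, and its
elements are pairwise incongruent modulo `M`. -/
structure IsDigitSet (M : Matrix (Fin d) (Fin d) ℤ) (D : Finset (Fin d → ℤ)) : Prop where
  zero_mem : (0 : Fin d → ℤ) ∈ D
  card_eq : D.card = M.det.natAbs
  incongruent : ∀ a ∈ D, ∀ b ∈ D, a ≠ b → ¬ ∃ s : Fin d → ℤ, a - b = M *ᵥ s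

/-- The matrix `M` with real entries. -/
def realMat (M : Matrix (Fin d) (Fin d) ℤ) : Matrix (Fin d) (Fin d) ℝ :=
  M.map (fun a : ℤ => (a : ℝ))

/-- An integer vector as a vector of `ℝ^d`. -/
def realVec (v : Fin d → ℤ) : Fin d → ℝ := fun i => (v i : ℝ)

/-- The image `M^n(S)`, `n ∈ ℤ`. -/
def powImage (M : Matrix (Fin d) (Fin d) ℤ) (n : ℤ) (S : Set (Fin d → ℝ)) : Set (Fin d → ℝ) :=
  (fun x => (realMat M ^ n) *ᵥ x) '' S

/-- `x = ∑_{j ∈ ℤ} M^{-j} a_j` with digits `a_j ∈ D`, of which only finitely many with negative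
index are nonzero. -/
structure IsExpansion (M : Matrix (Fin d) (Fin d) ℤ) (D : Finset (Fin d → ℤ))
    (x : Fin d → ℝ) (a : ℤ → Fin d → ℤ) : Prop where
  digit_mem : ∀ j, a j ∈ D
  finite_neg : {j : ℤ | j < 0 ∧ a j ≠ 0}.Finite
  hasSum : HasSum (fun j : ℤ => (realMat M ^ (-j)) *ᵥ realVec (a j)) x

/-- An expansion with finitely many nonzero digits. -/
def IsFiniteExpansion (M : Matrix (Fin d) (Fin d) ℤ) (D : Finset (Fin d → ℤ))
    (x : Fin d → ℝ) (a : ℤ → Fin d → ℤ) : Prop :=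
  IsExpansion M D x a ∧ {j : ℤ | a j ≠ 0}.Finite

/-- An expansion `x = ∑_{j ≥ 1} M^{-j} a_j`. -/
def IsFractionalExpansion (M : Matrix (Fin d) (Fin d) ℤ) (D : Finset (Fin d → ℤ))
    (x : Fin d → ℝ) (a : ℤ → Fin d → ℤ) : Prop :=
  IsExpansion M D x a ∧ ∀ j ≤ 0, a j = 0

/-- The set `X⁺` of all vectors having an expansion. -/
def XPlus (M : Matrix (Fin d) (Fin d) ℤ) (D : Finset (Fin d → ℤ)) : Set (Fin d → ℝ) :=
  {x | ∃ a, IsExpansion M D x a}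

/-- The set `X⁰` of all vectors having a finite expansion. -/
def XZero (M : Matrix (Fin d) (Fin d) ℤ) (D : Finset (Fin d → ℤ)) : Set (Fin d → ℝ) :=
  {x | ∃ a, IsFiniteExpansion M D x a}

/-- The exceptional set `Ũ ⊆ U⁺`: the vectors with two expansions `∑_{j ≥ 1} M^{-j} u_j` whose
first digits differ, i.e. the union of the overlaps of the pieces `M⁻¹U⁺ + M⁻¹s`, `s ∈ D`. -/
def UTilde (M : Matrix (Fin d) (Fin d) ℤ) (D : Finset (Fin d → ℤ)) : Set (Fin d → ℝ) :=
  {u | ∃ a b, IsFractionalExpansion M D u a ∧ IsFractionalExpansion M D u b ∧ a 1 ≠ b 1}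

/-- `X̃ = ⋃_{h ∈ X⁰} ⋃_{n ∈ ℤ} M^n(Ũ + h)`. -/
def XTilde (M : Matrix (Fin d) (Fin d) ℤ) (D : Finset (Fin d → ℤ)) : Set (Fin d → ℝ) :=
  ⋃ h ∈ XZero M D, ⋃ n : ℤ, powImage M n ((fun u => u + h) '' UTilde M D)

/-- The space of `M`-positive vectors `X = (X⁺ \ X̃) ∪ X⁰`. -/
def X (M : Matrix (Fin d) (Fin d) ℤ) (D : Finset (Fin d → ℤ)) : Set (Fin d → ℝ) :=
  (XPlus M D \ XTilde M D) ∪ XZero M D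

open Classical in
/-- The digits `x_j` of `x`: those of the finite expansion if there is one, and otherwise those of
the infinite expansion (which is unique if `x ∈ X`). The value is `0` off `X⁺`. -/
def digits (M : Matrix (Fin d) (Fin d) ℤ) (D : Finset (Fin d → ℤ)) (x : Fin d → ℝ) :
    ℤ → Fin d → ℤ :=
  if h : ∃ a, IsFiniteExpansion M D x a then h.choose
  else if h : ∃ a, IsExpansion M D x a then h.choose
  else 0

/-- `U = {x ∈ X : x_j = 0 for all j ≤ 0}`. -/
def U (M : Matrix (Fin d) (Fin d) ℤ) (D : Finset (Fin d → ℤ)) : Set (Fin d → ℝ) :=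
  {x | x ∈ X M D ∧ ∀ j ≤ 0, digits M D x j = 0}

/-- `χ(x, ω) = exp(2πi ∑_{j ∈ ℤ} ⟨M⁻¹ x_j, ω_{1-j}⟩)`, where `x_j` are the digits of `x` with respect
to `(M, D)` and `ω_j` those of `ω` with respect to `(Mᵀ, D')`. The sum has finitely many nonzero
terms. -/
def chi (M : Matrix (Fin d) (Fin d) ℤ) (D D' : Finset (Fin d → ℤ)) (x ω : Fin d → ℝ) : ℂ :=
  Complex.exp (2 * Real.pi * Complex.I *
    ((∑' j : ℤ, ((realMat M)⁻¹ *ᵥ realVec (digits M D x j)) ⬝ᵥ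
      realVec (digits Mᵀ D' ω (1 - j)) : ℝ) : ℂ))

/-- The Fourier transform of an integrable function:
`(1/μ(U)) ∫_X f(x) conj χ(x, ω) dμ(x)`. -/
def fourierIntegral (M : Matrix (Fin d) (Fin d) ℤ) (D D' : Finset (Fin d → ℤ))
    (f : (Fin d → ℝ) → ℂ) (ω : Fin d → ℝ) : ℂ :=
  (1 / (volume.real (U M D) : ℂ)) * ∫ x in X M D, f x * starRingEnd ℂ (chi M D D' x ω)

/-- The truncated transform
`J_l f(ω) = (1/μ(U)) ∫_{M^l(U)} f(x) conj χ(x, ω) dμ(x)`. -/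
def J (M : Matrix (Fin d) (Fin d) ℤ) (D D' : Finset (Fin d → ℤ)) (l : ℕ)
    (f : (Fin d → ℝ) → ℂ) (ω : Fin d → ℝ) : ℂ :=
  (1 / (volume.real (U M D) : ℂ)) *
    ∫ x in powImage M l (U M D), f x * starRingEnd ℂ (chi M D D' x ω)

/-- `F` is (a representative of) the `L²` Fourier transform of `f`: `F ∈ L²(X*)` and
`J_l f → F` in `L²(X*)` as `l → ∞`. -/
def IsFourierTransform (M : Matrix (Fin d) (Fin d) ℤ) (D D' : Finset (Fin d → ℤ))
    (f F : (Fin d → ℝ) → ℂ) : Prop :=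
  MemLp F 2 (volume.restrict (X Mᵀ D')) ∧
  (∀ l : ℕ, MemLp (J M D D' l f) 2 (volume.restrict (X Mᵀ D'))) ∧
  Tendsto (fun l : ℕ => eLpNorm (fun ω => J M D D' l f ω - F ω) 2 (volume.restrict (X Mᵀ D')))
    atTop (𝓝 0)

end MPositive

end

/-!
Up to null sets, `X` is the space of digit sequences of `(M, D)`, with the product of the uniform
measures on `D`, `X*` is the space of digit sequences of `(Mᵀ, D')`, and `χ` pairs the digit of
index `j` of `x` with the digit of index `1 - j` of `ω`. The theorem is the Plancherel theorem for
this product structure.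

Geometrically, the set `U⁺ = cylinder M D 0 0` of all
`∑_{j ≥ 1} M^{-j} u_j` is compact, and its translates by integer vectors cover `ℝ^d` (iterated
division with remainder by `M`), so that its volume is positive and finite. It is the union of
its `m` pieces `M⁻¹(U⁺ + s)`, each of volume `μ(U⁺) / m`, so that the pieces overlap in null sets
(`IsDigitSystem.volume_inter_pieces`); therefore `X̃` is a null set, almost every vector of `X⁺` has
a unique expansion (`IsDigitSystem.ae_mem_cylinder_iff`), and the set of the vectors with prescribed
digits up to the index `n` is, up to a null set, an affine image of `U⁺` of volume `m^{-n} μ(U)`.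

The numbers `exp(2πi ⟨M⁻¹a, b⟩)`, `a ∈ D`, `b ∈ D'`, form the character table of `ℤ^d / Mℤ^d`
(`IsDigitSystem.sum_digitChar_mul_conj`). Multiplied over a window of digits, the orthogonality
relations show that the functions `x ↦ χ(x, ω)`, where `ω` has no digits of index bigger than `l`,
are orthogonal on `M^l(U)`, with squared norm `m^l μ(U)`. They are complete there
(`IsDigitSystem.ae_eq_zero_of_orthogonal`): their combinations include all functions of finitely
many digits, and a test function is the pointwise limit of its values at truncated expansions.

On the set of all `ω` with prescribed digits of index at most `l`, of volume `m^{-l} μ(U*)`, the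
function `J_l f` is almost everywhere constant, its value being a multiple of a Fourier coefficient
of `f` on `M^l(U)`. Parseval's
identity thus says that `J_l` is `√(μ(U*) / μ(U))` times an isometry on `L²(M^l(U))`
(`IsDigitSystem.eLpNorm_J`). As `J_k f` is the transform `J_l` of the restriction of `f` to `M^k(U)`
for `k ≤ l`, the functions `J_l f` form a Cauchy sequence, and Plancherel's identity follows in the
limit. Polarization gives Parseval's identity, and dominated convergence the formula for integrable
functions.
-/

namespace MPositive

variable {d : ℕ} {M : Matrix (Fin d) (Fin d) ℤ} {D D' : Finset (Fin d → ℤ)}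

/-! ### Expanding matrices and complete residue systems -/

/-- The standing hypotheses on a pair `(M, D)`: an expanding integer matrix with a set of digits. -/
structure IsDigitSystem (M : Matrix (Fin d) (Fin d) ℤ) (D : Finset (Fin d → ℤ)) : Prop where
  two_le : 2 ≤ M.det.natAbs
  dilation : IsDilation M
  digitSet : IsDigitSet M D

lemma IsDilation.transpose (h : IsDilation M) : IsDilation Mᵀ := by
  intro z hz
  refine h z ?_
  rw [spectrum.mem_iff, Matrix.isUnit_iff_isUnit_det] at hz ⊢
  rw [← Matrix.det_transpose]
  convert hz using 4
  simp [Matrix.transpose_sub, Matrix.algebraMap_eq_diagonal, Matrix.transpose_map]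

lemma det_realMat : (realMat M).det = (M.det : ℝ) := by
  have := (Int.castRingHom ℝ).map_det M
  simpa [realMat, RingHom.mapMatrix_apply] using this.symm

lemma IsDigitSystem.det_ne_zero (h : IsDigitSystem M D) : M.det ≠ 0 := by
  intro h0
  have := h.two_le
  simp [h0] at this

lemma IsDigitSystem.isUnit_det (h : IsDigitSystem M D) : IsUnit (realMat M).det := by
  rw [det_realMat, isUnit_iff_ne_zero]
  exact_mod_cast h.det_ne_zero

lemma IsDigitSystem.dim_pos (h : IsDigitSystem M D) : 0 < d := by
  rcases Nat.eq_zero_or_pos d with rfl | h0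
  · have := h.two_le
    simp at this
  · exact h0

lemma IsDigitSystem.mulVec_zpow_add (h : IsDigitSystem M D) (a b : ℤ) (v : Fin d → ℝ) :
    (realMat M ^ a) *ᵥ ((realMat M ^ b) *ᵥ v) = (realMat M ^ (a + b)) *ᵥ v := by
  rw [Matrix.mulVec_mulVec, Matrix.zpow_add h.isUnit_det]

lemma realVec_zero : realVec (0 : Fin d → ℤ) = 0 := by
  ext i; simp [realVec]

lemma realVec_add (a b : Fin d → ℤ) : realVec (a + b) = realVec a + realVec b := by
  ext i; simp [realVec]

lemma realVec_mulVec (v : Fin d → ℤ) : realVec (M *ᵥ v) = realMat M *ᵥ realVec v := by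
  ext i; simp [realVec, realMat, Matrix.mulVec, dotProduct]

lemma realVec_injective : Function.Injective (realVec : (Fin d → ℤ) → Fin d → ℝ) := by
  intro a b h
  ext i
  have := congrFun h i
  simpa [realVec] using this

section Contraction

attribute [local instance] Matrix.linftyOpNormedAddCommGroup Matrix.linftyOpNormedRing
  Matrix.linftyOpNormedAlgebra Matrix.linftyOpNormedSpace

/-- If all elements of the spectrum of `A` have modulus bigger than `1`, the norms of the powers
of `A⁻¹` are summable, by Gelfand's formula for the spectral radius. -/
lemma summable_norm_inv_pow {A : Matrix (Fin d) (Fin d) ℂ} (hd : 0 < d) (hA : IsUnit A.det)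
    (h : ∀ z ∈ spectrum ℂ A, 1 < ‖z‖) : Summable fun n : ℕ => ‖A⁻¹ ^ n‖ := by
  have : Nonempty (Fin d) := ⟨⟨0, hd⟩⟩
  have : CompleteSpace (Matrix (Fin d) (Fin d) ℂ) := FiniteDimensional.complete ℂ _
  have hrad : spectralRadius ℂ A⁻¹ < 1 := by
    refine spectrum.spectralRadius_lt_of_forall_lt (r := 1) _ fun z hz => ?_
    have hu := (Matrix.isUnit_iff_isUnit_det A).2 hA
    obtain ⟨u, rfl⟩ := hu
    rw [← Matrix.coe_units_inv, ← spectrum.map_inv] at hz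
    have h1 := h _ (Set.mem_inv.1 hz)
    rw [norm_inv] at h1
    have h2 : 0 < ‖z‖ := by
      by_contra h0
      have : ‖z‖ = 0 := le_antisymm (not_lt.1 h0) (norm_nonneg _)
      simp [this] at h1
      linarith
    rw [← NNReal.coe_lt_coe]
    simpa using (one_lt_inv₀ h2).1 h1
  obtain ⟨r, hr0, hr1⟩ := exists_between hrad
  lift r to NNReal using (hr1.trans ENNReal.one_lt_top).ne
  have hlim := spectrum.pow_nnnorm_pow_one_div_tendsto_nhds_spectralRadius A⁻¹
  have hev := hlim.eventually_lt_const hr0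
  have hr1' : (r : ℝ) < 1 := by exact_mod_cast hr1
  refine Summable.of_norm_bounded_eventually_nat
    (summable_geometric_of_lt_one r.2 hr1') ?_
  filter_upwards [hev, eventually_gt_atTop 0] with n hn hn0
  rw [one_div] at hn
  have h3 : (‖A⁻¹ ^ n‖₊ : ℝ≥0∞) ≤ (r : ℝ≥0∞) ^ n := by
    have h4 := ENNReal.rpow_le_rpow hn.le (Nat.cast_nonneg n : (0 : ℝ) ≤ n)
    rwa [← ENNReal.rpow_mul, inv_mul_cancel₀ (by positivity), ENNReal.rpow_one,
      ENNReal.rpow_natCast] at h4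
  rw [norm_norm]
  exact_mod_cast h3

/-- The negative powers of `M` contract, with summable constants. -/
lemma IsDigitSystem.exists_summable_bound (h : IsDigitSystem M D) :
    ∃ b : ℕ → ℝ, Summable b ∧ ∀ (n : ℕ) (v : Fin d → ℝ),
      ‖(realMat M ^ (-(n : ℤ))) *ᵥ v‖ ≤ b n * ‖v‖ := by
  have hmap : M.map (fun a : ℤ => (a : ℂ)) = (realMat M).map (Complex.ofRealHom) := by
    ext i j; simp [realMat]
  have hdet : IsUnit (M.map (fun a : ℤ => (a : ℂ))).det := by
    rw [hmap, ← RingHom.mapMatrix_apply, ← RingHom.map_det]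
    exact h.isUnit_det.map _
  refine ⟨_, summable_norm_inv_pow h.dim_pos hdet h.dilation, fun n v => ?_⟩
  refine (Matrix.linfty_opNorm_mulVec _ _).trans ?_
  refine mul_le_mul_of_nonneg_right (le_of_eq ?_) (norm_nonneg _)
  have hinv : (M.map (fun a : ℤ => (a : ℂ)))⁻¹ ^ n
      = (realMat M ^ (-(n : ℤ))).map Complex.ofRealHom := by
    rw [Matrix.inv_pow', Matrix.zpow_neg_natCast]
    refine Matrix.inv_eq_left_inv ?_
    have h1 : (realMat M ^ n)⁻¹ * (realMat M ^ n) = 1 :=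
      Matrix.nonsing_inv_mul _ (by rw [Matrix.det_pow]; exact h.isUnit_det.pow n)
    have h2 := congrArg (Complex.ofRealHom.mapMatrix) h1
    rw [map_mul, map_pow, map_one] at h2
    simpa [hmap] using h2
  rw [hinv, Matrix.linfty_opNorm_def, Matrix.linfty_opNorm_def]
  simp

end Contraction

/-- A set of digits is a complete residue system, since `Mℤ^d` has index `|det M|`. -/
lemma IsDigitSystem.exists_residue (h : IsDigitSystem M D) (z : Fin d → ℤ) :
    ∃ a ∈ D, ∃ s : Fin d → ℤ, z = a + M *ᵥ s := by
  classical
  let N : Submodule ℤ (Fin d → ℤ) := LinearMap.range M.mulVecLin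
  -- `D` injects into `ℤ^d / Mℤ^d`, and both have `|det M|` elements.
  have hinj : Function.Injective M.mulVecLin := by
    intro a b hab
    have h1 := congrArg realVec hab
    simp only [Matrix.mulVecLin_apply, realVec_mulVec] at h1
    have h2 := Matrix.mulVec_injective_of_isUnit
      ((Matrix.isUnit_iff_isUnit_det _).2 h.isUnit_det) h1
    exact realVec_injective h2
  let e : (Fin d → ℤ) ≃ₗ[ℤ] N := LinearEquiv.ofInjective M.mulVecLin hinj
  have hcard : Nat.card ((Fin d → ℤ) ⧸ N) = M.det.natAbs := by
    rw [← Submodule.natAbs_det_equiv N e, ← LinearMap.det_toLin' M]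
    rfl
  have hfin : Finite ((Fin d → ℤ) ⧸ N) := by
    refine Nat.finite_of_card_ne_zero ?_
    have := h.two_le
    omega
  let φ : D → (Fin d → ℤ) ⧸ N := fun a => N.mkQ a
  have hφ : Function.Injective φ := by
    rintro ⟨a, ha⟩ ⟨b, hb⟩ hab
    by_contra hne
    refine h.digitSet.incongruent a ha b hb (fun h' => hne (Subtype.ext h')) ?_
    have h1 : a - b ∈ N := (Submodule.Quotient.eq N).1 hab
    obtain ⟨s, hs⟩ := h1
    exact ⟨s, hs.symm⟩
  have hbij : Function.Bijective φ := by
    refine (Nat.bijective_iff_injective_and_card φ).2 ⟨hφ, ?_⟩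
    rw [hcard, ← h.digitSet.card_eq]
    simp
  obtain ⟨⟨a, ha⟩, hza⟩ := hbij.2 (N.mkQ z)
  obtain ⟨s, hs⟩ := (Submodule.Quotient.eq N).1 hza.symm
  refine ⟨a, ha, s, ?_⟩
  have : M *ᵥ s = z - a := hs
  rw [this]; abel

/-! ### Expansions and their values -/

/-- Digit sequences with digits in `D` which vanish far enough to the left. -/
structure IsDigitSeq (D : Finset (Fin d → ℤ)) (a : ℤ → Fin d → ℤ) : Prop where
  mem : ∀ j, a j ∈ D
  vanish : ∃ N : ℤ, ∀ j ≤ N, a j = 0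

/-- The value `∑_{j ∈ ℤ} M^{-j} a_j` of a digit sequence. -/
noncomputable def value (M : Matrix (Fin d) (Fin d) ℤ) (a : ℤ → Fin d → ℤ) : Fin d → ℝ :=
  ∑' j : ℤ, (realMat M ^ (-j)) *ᵥ realVec (a j)

lemma IsExpansion.isDigitSeq {x : Fin d → ℝ} {a : ℤ → Fin d → ℤ} (h : IsExpansion M D x a) :
    IsDigitSeq D a := by
  refine ⟨h.digit_mem, ?_⟩
  obtain ⟨N, hN⟩ := h.finite_neg.bddBelow
  refine ⟨min N 0 - 1, fun j hj => ?_⟩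
  by_contra h0
  have := hN ⟨by omega, h0⟩
  omega

lemma IsExpansion.value_eq {x : Fin d → ℝ} {a : ℤ → Fin d → ℤ} (h : IsExpansion M D x a) :
    value M a = x := h.hasSum.tsum_eq

/-- The action of a power of `M` as a continuous linear map. -/
noncomputable def powL (M : Matrix (Fin d) (Fin d) ℤ) (n : ℤ) : (Fin d → ℝ) →L[ℝ] (Fin d → ℝ) :=
  LinearMap.toContinuousLinearMap (Matrix.toLin' (realMat M ^ n))

lemma powL_apply (n : ℤ) (v : Fin d → ℝ) : powL M n v = (realMat M ^ n) *ᵥ v := rfl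

lemma exists_norm_realVec_le (D : Finset (Fin d → ℤ)) :
    ∃ C : ℝ, 0 ≤ C ∧ ∀ v ∈ D, ‖realVec v‖ ≤ C := by
  refine ⟨∑ v ∈ D, ‖realVec v‖, Finset.sum_nonneg fun _ _ => norm_nonneg _, fun v hv => ?_⟩
  exact Finset.single_le_sum (f := fun v => ‖realVec v‖) (fun _ _ => norm_nonneg _) hv

/-- A summable bound for the terms of all expansions without integral digits. -/
lemma IsDigitSystem.exists_summable_majorant (h : IsDigitSystem M D) :
    ∃ u : ℤ → ℝ, Summable u ∧ ∀ a : ℤ → Fin d → ℤ, (∀ j, a j ∈ D) → (∀ j ≤ 0, a j = 0) →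
      ∀ j, ‖(realMat M ^ (-j)) *ᵥ realVec (a j)‖ ≤ u j := by
  obtain ⟨b, hb, hbv⟩ := h.exists_summable_bound
  obtain ⟨C, hC0, hC⟩ := exists_norm_realVec_le D
  refine ⟨Function.extend (fun n : ℕ => (n : ℤ)) (fun n => |b n| * C) 0, ?_, ?_⟩
  · rw [← Function.Injective.summable_iff (g := fun n : ℕ => (n : ℤ)) Nat.cast_injective]
    · rw [Function.extend_comp Nat.cast_injective]
      exact hb.abs.mul_right C
    · intro x hx
      exact Function.extend_apply' _ _ _ hx
  · intro a haD ha0 j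
    rcases lt_or_ge j 0 with hj | hj
    · rw [ha0 j hj.le, realVec_zero, Matrix.mulVec_zero, norm_zero, Function.extend_apply']
      · simp
      · rintro ⟨n, rfl⟩
        omega
    · lift j to ℕ using hj
      rw [Nat.cast_injective.extend_apply (f := fun n : ℕ => (n : ℤ))]
      refine (hbv j _).trans ?_
      exact mul_le_mul (le_abs_self _) (hC _ (haD _)) (norm_nonneg _) (abs_nonneg _)

lemma IsDigitSystem.summable (h : IsDigitSystem M D) {a : ℤ → Fin d → ℤ} (ha : IsDigitSeq D a) :
    Summable fun j : ℤ => (realMat M ^ (-j)) *ᵥ realVec (a j) := by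
  obtain ⟨u, hu, hb⟩ := h.exists_summable_majorant
  obtain ⟨N, hN⟩ := ha.vanish
  have h1 : Summable fun j : ℤ => (realMat M ^ (-j)) *ᵥ realVec (a (j + N)) :=
    Summable.of_norm_bounded hu
      (hb (fun j => a (j + N)) (fun j => ha.mem _) (fun j hj => hN _ (by omega)))
  rw [← (Equiv.addRight N).summable_iff]
  refine (h1.map (powL M (-N)) (powL M (-N)).continuous).congr fun j => ?_
  simp only [Function.comp, powL_apply, h.mulVec_zpow_add, Equiv.coe_addRight]
  congr 2
  ring

lemma IsDigitSystem.isExpansion_value (h : IsDigitSystem M D) {a : ℤ → Fin d → ℤ}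
    (ha : IsDigitSeq D a) : IsExpansion M D (value M a) a := by
  refine ⟨ha.mem, ?_, (h.summable ha).hasSum⟩
  obtain ⟨N, hN⟩ := ha.vanish
  refine (Set.finite_Ioo N 0).subset fun j hj => ⟨?_, hj.1⟩
  by_contra h0
  exact hj.2 (hN _ (by omega))

lemma IsDigitSystem.isExpansion_iff (h : IsDigitSystem M D) {a : ℤ → Fin d → ℤ}
    {x : Fin d → ℝ} : IsExpansion M D x a ↔ IsDigitSeq D a ∧ value M a = x := by
  refine ⟨fun hx => ⟨hx.isDigitSeq, hx.value_eq⟩, ?_⟩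
  rintro ⟨ha, rfl⟩
  exact h.isExpansion_value ha

lemma IsDigitSeq.shift {a : ℤ → Fin d → ℤ} (ha : IsDigitSeq D a) (n : ℤ) :
    IsDigitSeq D (fun j => a (j + n)) := by
  obtain ⟨N, hN⟩ := ha.vanish
  exact ⟨fun j => ha.mem _, N - n, fun j hj => hN _ (by omega)⟩

/-- Shifting the digits by `n` places multiplies the value by `M^n`. -/
lemma IsDigitSystem.value_shift (h : IsDigitSystem M D) {a : ℤ → Fin d → ℤ}
    (ha : IsDigitSeq D a) (n : ℤ) :
    value M (fun j => a (j + n)) = (realMat M ^ n) *ᵥ value M a := by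
  have h1 := (powL M n).hasSum (h.summable ha).hasSum
  rw [← (Equiv.addRight n).hasSum_iff] at h1
  refine HasSum.tsum_eq (h1.congr_fun fun j => ?_)
  simp only [Function.comp, powL_apply, h.mulVec_zpow_add, Equiv.coe_addRight]
  congr 2
  ring

/-- The digits of index at most `n`. -/
def trunc (n : ℤ) (a : ℤ → Fin d → ℤ) : ℤ → Fin d → ℤ := fun j => if j ≤ n then a j else 0

/-- The digits of index bigger than `n`. -/
def tail (n : ℤ) (a : ℤ → Fin d → ℤ) : ℤ → Fin d → ℤ := fun j => if j ≤ n then 0 else a j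

lemma IsDigitSystem.isDigitSeq_trunc (h : IsDigitSystem M D) {a : ℤ → Fin d → ℤ}
    (ha : IsDigitSeq D a) (n : ℤ) : IsDigitSeq D (trunc n a) := by
  obtain ⟨N, hN⟩ := ha.vanish
  refine ⟨fun j => ?_, N, fun j hj => ?_⟩
  · unfold trunc; split_ifs
    exacts [ha.mem j, h.digitSet.zero_mem]
  · unfold trunc; split_ifs
    exacts [hN j hj, rfl]

lemma IsDigitSystem.isDigitSeq_tail (h : IsDigitSystem M D) {a : ℤ → Fin d → ℤ}
    (ha : IsDigitSeq D a) (n : ℤ) : IsDigitSeq D (tail n a) := by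
  refine ⟨fun j => ?_, n, fun j hj => by simp [tail, hj]⟩
  unfold tail; split_ifs
  exacts [h.digitSet.zero_mem, ha.mem j]

lemma IsDigitSystem.value_eq_add (h : IsDigitSystem M D) {a b c : ℤ → Fin d → ℤ}
    (ha : IsDigitSeq D a) (hb : IsDigitSeq D b) (hc : ∀ j, c j = a j + b j) :
    value M c = value M a + value M b := by
  refine HasSum.tsum_eq (((h.summable ha).hasSum.add (h.summable hb).hasSum).congr_fun fun j => ?_)
  rw [hc, realVec_add, Matrix.mulVec_add]

lemma trunc_add_tail (n : ℤ) (a : ℤ → Fin d → ℤ) (j : ℤ) : a j = trunc n a j + tail n a j := by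
  unfold trunc tail; split_ifs <;> simp

/-! ### Cylinder sets -/

/-- The cylinder set of all vectors with an expansion whose digits of index at most `n` are those of
`a`. In particular `cylinder M D 0 0` is the set of all `∑_{j ≥ 1} M^{-j} u_j` with `u_j ∈ D`. -/
def cylinder (M : Matrix (Fin d) (Fin d) ℤ) (D : Finset (Fin d → ℤ)) (n : ℤ)
    (a : ℤ → Fin d → ℤ) : Set (Fin d → ℝ) :=
  {x | ∃ b, IsExpansion M D x b ∧ ∀ j ≤ n, b j = a j}

/-- Up to translation, all cylinder sets are images of `cylinder M D 0 0` under powers of `M`. -/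
lemma IsDigitSystem.cylinder_eq (h : IsDigitSystem M D) (n : ℤ) {a : ℤ → Fin d → ℤ}
    (ha : IsDigitSeq D a) :
    cylinder M D n a = (fun u => powL M (-n) u + value M (trunc n a)) ''
      cylinder M D 0 0 := by
  ext x
  constructor
  · rintro ⟨b, hb, hba⟩
    have hbs := hb.isDigitSeq
    have ht := (h.isDigitSeq_tail hbs n).shift n
    refine ⟨_, ⟨_, h.isExpansion_value ht, fun j hj => ?_⟩, ?_⟩
    · simp [tail, hj]
    · simp only [powL_apply]
      rw [h.value_shift (h.isDigitSeq_tail hbs n), h.mulVec_zpow_add, neg_add_cancel, zpow_zero,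
        Matrix.one_mulVec]
      have : trunc n a = trunc n b := by
        funext j; unfold trunc; split_ifs with hj
        exacts [(hba j hj).symm, rfl]
      rw [this, add_comm, ← h.value_eq_add (h.isDigitSeq_trunc hbs n) (h.isDigitSeq_tail hbs n)
        (trunc_add_tail n b), hb.value_eq]
  · rintro ⟨_, ⟨u, hu, hu0⟩, rfl⟩
    have hus := hu.isDigitSeq
    refine ⟨fun j => if j ≤ n then a j else u (j + -n), ?_, fun j hj => by simp [hj]⟩
    have hz : IsDigitSeq D (fun j => if j ≤ n then a j else u (j + -n)) := by
      obtain ⟨N, hN⟩ := ha.vanish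
      refine ⟨fun j => ?_, min N n, fun j hj => ?_⟩
      · split_ifs
        exacts [ha.mem j, hus.mem _]
      · rw [if_pos (by omega), hN j (by omega)]
    refine h.isExpansion_iff.2 ⟨hz, ?_⟩
    dsimp only
    rw [powL_apply, ← hu.value_eq, ← h.value_shift hus, add_comm]
    refine h.value_eq_add (h.isDigitSeq_trunc ha n) (hus.shift _) fun j => ?_
    unfold trunc
    split_ifs with hj
    · rw [hu0 _ (by omega)]; simp
    · simp

/-- `cylinder M D 0 0` is a continuous image of a product of copies of the finite set `D`. -/
lemma IsDigitSystem.isCompact_cylinder_zero (h : IsDigitSystem M D) :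
    IsCompact (cylinder M D 0 0) := by
  let ext : (ℤ → D) → ℤ → Fin d → ℤ := fun s j => if j ≤ 0 then 0 else s j
  have hext : ∀ s, IsDigitSeq D (ext s) := fun s => by
    refine ⟨fun j => ?_, 0, fun j hj => by simp [ext, hj]⟩
    simp only [ext]; split_ifs
    exacts [h.digitSet.zero_mem, (s j).2]
  have heq : cylinder M D 0 0 = Set.range fun s => value M (ext s) := by
    ext x
    constructor
    · rintro ⟨b, hb, hb0⟩
      refine ⟨fun j => ⟨b j, hb.digit_mem j⟩, ?_⟩
      refine Eq.trans ?_ hb.value_eq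
      refine congrArg (value M) ?_
      funext j
      simp only [ext]; split_ifs with hj
      exacts [(hb0 j hj).symm, rfl]
    · rintro ⟨s, rfl⟩
      exact ⟨_, h.isExpansion_value (hext s), fun j hj => by simp [ext, hj]⟩
  rw [heq]
  refine isCompact_range ?_
  obtain ⟨u, hu, hb⟩ := h.exists_summable_majorant
  refine continuous_tsum (fun j => ?_) hu fun j s =>
    hb (ext s) (hext s).mem (fun j hj => by simp [ext, hj]) j
  refine (powL M (-j)).continuous.comp ?_
  have : Continuous fun t : D => realVec (if j ≤ 0 then 0 else (t : Fin d → ℤ)) :=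
    continuous_of_discreteTopology
  exact this.comp (continuous_apply j)

lemma IsDigitSystem.isCompact_cylinder (h : IsDigitSystem M D) (n : ℤ) {a : ℤ → Fin d → ℤ}
    (ha : IsDigitSeq D a) : IsCompact (cylinder M D n a) := by
  rw [h.cylinder_eq n ha]
  exact h.isCompact_cylinder_zero.image (by fun_prop)

lemma IsDigitSystem.measurableSet_cylinder (h : IsDigitSystem M D) (n : ℤ) {a : ℤ → Fin d → ℤ}
    (ha : IsDigitSeq D a) : MeasurableSet (cylinder M D n a) :=
  (h.isCompact_cylinder n ha).measurableSet

lemma IsDigitSystem.isDigitSeq_zero (h : IsDigitSystem M D) :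
    IsDigitSeq D (0 : ℤ → Fin d → ℤ) := ⟨fun _ => h.digitSet.zero_mem, 0, fun _ _ => rfl⟩

/-- Truncated expansions converge to the expanded vector. -/
lemma IsDigitSystem.tendsto_value_trunc (h : IsDigitSystem M D) {a : ℤ → Fin d → ℤ}
    (ha : IsDigitSeq D a) :
    Tendsto (fun n : ℕ => value M (trunc n a)) atTop (𝓝 (value M a)) := by
  obtain ⟨b, hb, hbv⟩ := h.exists_summable_bound
  obtain ⟨C, hC⟩ := h.isCompact_cylinder_zero.isBounded.exists_norm_le
  rw [tendsto_iff_norm_sub_tendsto_zero]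
  have hlim : Tendsto (fun n : ℕ => |b n| * C) atTop (𝓝 0) := by
    simpa using hb.abs.tendsto_atTop_zero.mul_const C
  refine squeeze_zero (fun _ => norm_nonneg _) (fun n => ?_) hlim
  have h1 : value M a ∈ cylinder M D n a := ⟨a, h.isExpansion_value ha, fun _ _ => rfl⟩
  rw [h.cylinder_eq n ha] at h1
  obtain ⟨u, hu, hu1⟩ := h1
  rw [← hu1, norm_sub_rev]
  simp only [add_sub_cancel_right]
  refine (hbv n u).trans ?_
  exact mul_le_mul (le_abs_self _) (hC u hu) (norm_nonneg _) (abs_nonneg _)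

/-! ### The measure of cylinder sets -/

lemma IsDigitSystem.volume_image_powL (h : IsDigitSystem M D) (n : ℤ) (s : Set (Fin d → ℝ)) :
    volume (powL M n '' s) = (M.det.natAbs : ℝ≥0∞) ^ n * volume s := by
  have h1 : powL M n '' s = (Matrix.toLin' (realMat M ^ n)) '' s := rfl
  rw [h1, Measure.addHaar_image_linearMap, LinearMap.det_toLin']
  congr 1
  have hdet : ∀ n : ℤ, (realMat M ^ n).det = (realMat M).det ^ n := by
    intro n
    rcases n with n | n
    · simp
    · rw [zpow_negSucc, zpow_negSucc, Matrix.det_nonsing_inv, Ring.inverse_eq_inv', Matrix.det_pow]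
  rw [hdet, det_realMat, abs_zpow, ← Int.cast_abs, Int.abs_eq_natAbs]
  have hpos : (0 : ℝ) < M.det.natAbs := by
    exact_mod_cast Int.natAbs_pos.2 h.det_ne_zero
  rw [Int.cast_natCast, ← ENNReal.ofReal_natCast M.det.natAbs,
    ← ENNReal.rpow_intCast, ← Real.rpow_intCast, ENNReal.ofReal_rpow_of_pos hpos]

lemma IsDigitSystem.volume_cylinder (h : IsDigitSystem M D) (n : ℤ) {a : ℤ → Fin d → ℤ}
    (ha : IsDigitSeq D a) :
    volume (cylinder M D n a) = (M.det.natAbs : ℝ≥0∞) ^ (-n) * volume (cylinder M D 0 0) := by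
  rw [h.cylinder_eq n ha, ← h.volume_image_powL]
  have : (fun u => powL M (-n) u + value M (trunc n a)) '' cylinder M D 0 0
      = (fun y => y + value M (trunc n a)) '' (powL M (-n) '' cylinder M D 0 0) := by
    rw [Set.image_image]
  rw [this, Set.image_add_right, measure_preimage_add_right]

lemma IsDigitSystem.volume_cylinder_zero_lt_top (h : IsDigitSystem M D) :
    volume (cylinder M D 0 0) < ∞ := h.isCompact_cylinder_zero.measure_lt_top

lemma value_single (i : ℤ) (s : Fin d → ℤ) :
    value M (Pi.single i s) = (realMat M ^ (-i)) *ᵥ realVec s := by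
  unfold value
  rw [tsum_eq_single i]
  · simp
  · intro j hj
    rw [Pi.single_eq_of_ne hj, realVec_zero, Matrix.mulVec_zero]

lemma IsDigitSystem.isDigitSeq_single (h : IsDigitSystem M D) (i : ℤ) {s : Fin d → ℤ}
    (hs : s ∈ D) : IsDigitSeq D (Pi.single i s) := by
  refine ⟨fun j => ?_, i - 1, fun j hj => Pi.single_eq_of_ne (by omega) _⟩
  rcases eq_or_ne j i with rfl | hj
  · simpa using hs
  · rw [Pi.single_eq_of_ne hj]; exact h.digitSet.zero_mem

lemma cylinder_mono {m n : ℤ} (hmn : m ≤ n)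
    {a b : ℤ → Fin d → ℤ} (hab : ∀ j ≤ m, a j = b j) : cylinder M D n a ⊆ cylinder M D m b := by
  rintro x ⟨c, hc, hca⟩
  exact ⟨c, hc, fun j hj => (hca j (hj.trans hmn)).trans (hab j hj)⟩

lemma IsDigitSystem.inv_add_mem_cylinder_zero (h : IsDigitSystem M D) {u : Fin d → ℝ}
    (hu : u ∈ cylinder M D 0 0) {s : Fin d → ℤ} (hs : s ∈ D) :
    (realMat M ^ (-1 : ℤ)) *ᵥ (u + realVec s) ∈ cylinder M D 0 0 := by
  have h1 : (realMat M ^ (-1 : ℤ)) *ᵥ (u + realVec s) ∈ cylinder M D 1 (Pi.single 1 s) := by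
    rw [h.cylinder_eq 1 (h.isDigitSeq_single 1 hs)]
    refine ⟨u, hu, ?_⟩
    have : trunc 1 (Pi.single (1 : ℤ) s) = Pi.single 1 s := by
      funext j
      unfold trunc
      split_ifs with hj
      · rfl
      · rw [Pi.single_eq_of_ne (by omega)]
    simp only [powL_apply]
    rw [this, value_single, Matrix.mulVec_add]
  exact cylinder_mono zero_le_one (fun j hj => Pi.single_eq_of_ne (by omega) _) h1

/-! ### The translates of the self-affine tile cover the space -/

/-- Division with remainder in `ℤ^d`, iterated `n` times. -/
lemma IsDigitSystem.exists_integer_add_tile (h : IsDigitSystem M D) (n : ℕ) (z : Fin d → ℤ) :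
    ∃ k : Fin d → ℤ, ∃ u ∈ cylinder M D 0 0,
      (realMat M ^ (-(n : ℤ))) *ᵥ realVec z = realVec k + u := by
  induction n generalizing z with
  | zero =>
    refine ⟨z, 0, ⟨0, h.isExpansion_iff.2 ⟨h.isDigitSeq_zero, ?_⟩, fun _ _ => rfl⟩, by simp⟩
    simp [value, realVec_zero]
  | succ n ih =>
    obtain ⟨k, u, hu, hk⟩ := ih z
    obtain ⟨s, hs, t, ht⟩ := h.exists_residue k
    refine ⟨t, _, h.inv_add_mem_cylinder_zero hu hs, ?_⟩
    have h1 : (realMat M ^ (-((n + 1 : ℕ) : ℤ))) *ᵥ realVec z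
        = (realMat M ^ (-1 : ℤ)) *ᵥ ((realMat M ^ (-(n : ℤ))) *ᵥ realVec z) := by
      rw [h.mulVec_zpow_add]
      congr 2
      push_cast; ring
    have h2 : (realMat M ^ (-1 : ℤ)) *ᵥ (realMat M *ᵥ realVec t) = realVec t := by
      have := h.mulVec_zpow_add (-1) 1 (realVec t)
      simpa using this
    rw [h1, hk, ht, realVec_add, realVec_mulVec]
    simp only [Matrix.mulVec_add]
    rw [h2]
    abel

/-- The translates of `cylinder M D 0 0` by integer vectors cover the space. -/
lemma IsDigitSystem.exists_eq_integer_add_tile (h : IsDigitSystem M D) (x : Fin d → ℝ) :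
    ∃ k : Fin d → ℤ, ∃ u ∈ cylinder M D 0 0, x = realVec k + u := by
  -- The vectors `M^{-n} ⌊M^n x⌋ = k_n + u_n` converge to `x`. As the `u_n` lie in a compact set,
  -- a subsequence of the integer vectors `k_n` converges as well.
  obtain ⟨b, hb, hbv⟩ := h.exists_summable_bound
  let z : ℕ → Fin d → ℤ := fun n i => ⌊((realMat M ^ (n : ℤ)) *ᵥ x) i⌋
  choose k u hu hk using fun n => h.exists_integer_add_tile n (z n)
  have hconv : Tendsto (fun n => realVec (k n) + u n) atTop (𝓝 x) := by
    rw [tendsto_iff_norm_sub_tendsto_zero]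
    have hlim : Tendsto (fun n : ℕ => |b n| * 1) atTop (𝓝 0) := by
      simpa using hb.abs.tendsto_atTop_zero
    refine squeeze_zero (fun _ => norm_nonneg _) (fun n => ?_) hlim
    have hx : x = (realMat M ^ (-(n : ℤ))) *ᵥ ((realMat M ^ (n : ℤ)) *ᵥ x) := by
      rw [h.mulVec_zpow_add, neg_add_cancel, zpow_zero, Matrix.one_mulVec]
    rw [← hk, norm_sub_rev]
    nth_rewrite 1 [hx]
    rw [← Matrix.mulVec_sub]
    refine (hbv n _).trans (mul_le_mul (le_abs_self _) ?_ (norm_nonneg _) (abs_nonneg _))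
    refine (pi_norm_le_iff_of_nonneg zero_le_one).2 fun i => ?_
    have : ((realMat M ^ (n : ℤ)) *ᵥ x - realVec (z n)) i
        = Int.fract (((realMat M ^ (n : ℤ)) *ᵥ x) i) := by
      simp only [z, realVec, Pi.sub_apply, Int.self_sub_floor]
    rw [this, Real.norm_eq_abs, abs_of_nonneg (Int.fract_nonneg _)]
    exact (Int.fract_lt_one _).le
  obtain ⟨v, hv, φ, hφ, hφv⟩ := h.isCompact_cylinder_zero.tendsto_subseq hu
  have hk' : Tendsto (fun n => realVec (k (φ n))) atTop (𝓝 (x - v)) := by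
    have := (hconv.comp hφ.tendsto_atTop).sub hφv
    refine this.congr fun n => ?_
    simp
  have hint : ∀ i, ∃ l : ℤ, (l : ℝ) = (x - v) i := fun i => by
    have h1 := (continuous_apply i).continuousAt.tendsto.comp hk'
    exact Int.isClosedEmbedding_coe_real.isClosed_range.mem_of_tendsto h1
      (Eventually.of_forall fun n => ⟨k (φ n) i, rfl⟩)
  choose l hl using hint
  refine ⟨l, v, hv, ?_⟩
  ext i
  have := hl i
  simp only [realVec, Pi.add_apply, Pi.sub_apply] at this ⊢
  linarith

lemma IsDigitSystem.volume_cylinder_zero_pos (h : IsDigitSystem M D) :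
    0 < volume (cylinder M D 0 0) := by
  rw [pos_iff_ne_zero]
  intro h0
  have hcov : (Set.univ : Set (Fin d → ℝ)) ⊆
      ⋃ k : Fin d → ℤ, (fun u => u + realVec k) '' cylinder M D 0 0 := by
    intro x _
    obtain ⟨k, u, hu, rfl⟩ := h.exists_eq_integer_add_tile x
    exact Set.mem_iUnion.2 ⟨k, u, hu, add_comm _ _⟩
  have h1 : volume (⋃ k : Fin d → ℤ, (fun u => u + realVec k) '' cylinder M D 0 0) = 0 := by
    refine measure_iUnion_null fun k => ?_
    rw [Set.image_add_right, measure_preimage_add_right, h0]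
  have h2 := measure_mono_null hcov h1
  exact NeZero.ne (volume (Set.univ : Set (Fin d → ℝ))) h2

/-! ### The exceptional sets are null sets -/

/-- The pieces `M⁻¹(U⁺ + s)` of the tile `U⁺` overlap in null sets, as their volumes add up to the
volume of the tile. -/
lemma IsDigitSystem.volume_inter_pieces (h : IsDigitSystem M D) {s t : Fin d → ℤ} (hs : s ∈ D)
    (ht : t ∈ D) (hst : s ≠ t) :
    volume (cylinder M D 1 (Pi.single 1 s) ∩ cylinder M D 1 (Pi.single 1 t)) = 0 := by
  classical
  set T : (Fin d → ℤ) → Set (Fin d → ℝ) := fun s => cylinder M D 1 (Pi.single 1 s) with hT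
  have hmeas : ∀ r ∈ D, MeasurableSet (T r) := fun r hr =>
    h.measurableSet_cylinder 1 (h.isDigitSeq_single 1 hr)
  -- The pieces still cover the tile if the overlap, contained in `T t`, is removed from `T s`.
  have hcov : cylinder M D 0 0 ⊆ (⋃ r ∈ D.erase s, T r) ∪ (T s \ (T s ∩ T t)) := by
    rintro x ⟨b, hb, hb0⟩
    have hx : x ∈ T (b 1) := by
      refine ⟨b, hb, fun j hj => ?_⟩
      rcases eq_or_ne j 1 with rfl | hj1
      · simp
      · rw [Pi.single_eq_of_ne hj1, hb0 j (by omega)]; rfl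
    by_cases hbs : b 1 = s
    · rw [hbs] at hx
      by_cases hxt : x ∈ T t
      · exact Or.inl (Set.mem_biUnion (Finset.mem_erase.2 ⟨hst.symm, ht⟩) hxt)
      · exact Or.inr ⟨hx, fun h' => hxt h'.2⟩
    · exact Or.inl (Set.mem_biUnion (Finset.mem_erase.2 ⟨hbs, hb.digit_mem 1⟩) hx)
  have h1 : volume (cylinder M D 0 0) + volume (T s ∩ T t) ≤ volume (cylinder M D 0 0) + 0 := by
    calc volume (cylinder M D 0 0) + volume (T s ∩ T t)
        ≤ (∑ r ∈ D.erase s, volume (T r) + volume (T s \ (T s ∩ T t))) + volume (T s ∩ T t) := by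
          gcongr
          refine (measure_mono hcov).trans ((measure_union_le _ _).trans ?_)
          gcongr
          exact measure_biUnion_finset_le _ _
      _ = ∑ r ∈ D.erase s, volume (T r) + volume (T s) := by
          rw [add_assoc]
          congr 1
          have := measure_sdiff_add_inter (μ := volume) (T s) (hmeas t ht)
          rwa [Set.sdiff_self_inter]
      _ = ∑ r ∈ D, volume (T r) := Finset.sum_erase_add _ _ hs
      _ = ∑ r ∈ D, (M.det.natAbs : ℝ≥0∞) ^ (-1 : ℤ) * volume (cylinder M D 0 0) :=
          Finset.sum_congr rfl fun r hr => h.volume_cylinder 1 (h.isDigitSeq_single 1 hr)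
      _ = volume (cylinder M D 0 0) + 0 := by
          rw [Finset.sum_const, h.digitSet.card_eq, nsmul_eq_mul, ← mul_assoc, zpow_neg_one,
            ENNReal.mul_inv_cancel, one_mul, add_zero]
          · exact_mod_cast (Int.natAbs_pos.2 h.det_ne_zero).ne'
          · exact ENNReal.natCast_ne_top _
  exact nonpos_iff_eq_zero.1
    ((ENNReal.add_le_add_iff_left h.volume_cylinder_zero_lt_top.ne).1 h1)

lemma IsDigitSystem.volume_UTilde (h : IsDigitSystem M D) : volume (UTilde M D) = 0 := by
  have hsub : UTilde M D ⊆ ⋃ p ∈ (D ×ˢ D).filter (fun p => p.1 ≠ p.2),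
      cylinder M D 1 (Pi.single 1 p.1) ∩ cylinder M D 1 (Pi.single 1 p.2) := by
    rintro u ⟨a, b, ⟨ha, ha0⟩, ⟨hb, hb0⟩, hab⟩
    have key : ∀ c : ℤ → Fin d → ℤ, IsExpansion M D u c → (∀ j ≤ 0, c j = 0) →
        u ∈ cylinder M D 1 (Pi.single 1 (c 1)) := by
      intro c hc hc0
      refine ⟨c, hc, fun j hj => ?_⟩
      rcases eq_or_ne j 1 with rfl | hj1
      · simp
      · rw [Pi.single_eq_of_ne hj1, hc0 j (by omega)]
    refine Set.mem_biUnion (x := (a 1, b 1)) ?_ ⟨key a ha ha0, key b hb hb0⟩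
    simp [ha.digit_mem 1, hb.digit_mem 1, hab]
  refine measure_mono_null hsub ?_
  refine (measure_biUnion_null_iff (Finset.countable_toSet _)).2 fun p hp => ?_
  simp only [Finset.coe_filter, Finset.mem_product, Set.mem_ofPred_eq] at hp
  exact h.volume_inter_pieces hp.1.1 hp.1.2 hp.2

lemma countable_XZero (M : Matrix (Fin d) (Fin d) ℤ) (D : Finset (Fin d → ℤ)) :
    (XZero M D).Countable := by
  refine (Set.countable_range fun p : ℤ →₀ (Fin d → ℤ) => value M p).mono ?_
  rintro x ⟨a, ha, hfin⟩
  exact ⟨Finsupp.ofSupportFinite a hfin, ha.value_eq⟩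

lemma IsDigitSystem.volume_XTilde (h : IsDigitSystem M D) : volume (XTilde M D) = 0 := by
  unfold XTilde
  rw [measure_biUnion_null_iff (countable_XZero M D)]
  intro y _
  refine measure_iUnion_null fun n => ?_
  have : powImage M n ((fun u => u + y) '' UTilde M D)
      = powL M n '' ((fun u => u + y) '' UTilde M D) := rfl
  rw [this, h.volume_image_powL, Set.image_add_right, measure_preimage_add_right, h.volume_UTilde,
    mul_zero]

/-- Almost every vector avoids the exceptional sets. -/
lemma IsDigitSystem.ae_notMem (h : IsDigitSystem M D) :
    ∀ᵐ x : Fin d → ℝ, x ∉ XTilde M D ∧ x ∉ XZero M D := by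
  have : Nonempty (Fin d) := ⟨⟨0, h.dim_pos⟩⟩
  have h1 : ∀ᵐ x : Fin d → ℝ, x ∉ XTilde M D := measure_eq_zero_iff_ae_notMem.1 h.volume_XTilde
  have h2 : ∀ᵐ x : Fin d → ℝ, x ∉ XZero M D :=
    measure_eq_zero_iff_ae_notMem.1 ((countable_XZero M D).measure_zero _)
  exact h1.and h2

/-! ### The digits of almost every vector -/

/-- Off `X̃` expansions are unique: if two expansions of `x` first differ at the index `n + 1`, then
`M^n x` is the sum of an element of `Ũ` and of one of `X⁰`. -/
lemma IsDigitSystem.expansion_unique (h : IsDigitSystem M D) {x : Fin d → ℝ}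
    (hx : x ∉ XTilde M D) {a b : ℤ → Fin d → ℤ} (ha : IsExpansion M D x a)
    (hb : IsExpansion M D x b) : a = b := by
  by_contra hab
  have has := ha.isDigitSeq
  have hbs := hb.isDigitSeq
  obtain ⟨Na, hNa⟩ := has.vanish
  obtain ⟨Nb, hNb⟩ := hbs.vanish
  obtain ⟨i, hi, hmin⟩ := Int.exists_least_of_bdd (P := fun j => a j ≠ b j)
    ⟨min Na Nb, fun j hj => by
      by_contra hlt
      exact hj (by rw [hNa j (by omega), hNb j (by omega)])⟩ (Function.ne_iff.1 hab)
  set n := i - 1 with hn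
  have htr : trunc n a = trunc n b := by
    funext j
    unfold trunc
    split_ifs with hj
    · by_contra hne
      have := hmin j hne
      omega
    · rfl
  have hva := h.value_eq_add (h.isDigitSeq_trunc has n) (h.isDigitSeq_tail has n)
    (trunc_add_tail n a)
  have hvb := h.value_eq_add (h.isDigitSeq_trunc hbs n) (h.isDigitSeq_tail hbs n)
    (trunc_add_tail n b)
  have hta : value M (tail n a) = value M (tail n b) := by
    rw [ha.value_eq] at hva
    rw [hb.value_eq, ← htr] at hvb
    exact add_left_cancel (hva.symm.trans hvb)
  -- `M^n x` is the sum of the value of the common integral digits, which lies in `X⁰`, and of the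
  -- common value of two fractional expansions with different first digits.
  refine hx (Set.mem_biUnion (x := value M (fun j => trunc n a (j + n))) ?_ ?_)
  · refine ⟨_, h.isExpansion_value ((h.isDigitSeq_trunc has n).shift n), ?_⟩
    refine (Set.finite_Icc (Na - n) 0).subset fun j hj => ?_
    constructor
    · by_contra hlt
      refine hj ?_
      simp only [trunc]
      rw [hNa _ (by omega)]; simp
    · by_contra hlt
      refine hj ?_
      simp only [trunc]
      rw [if_neg (by omega)]
  · refine Set.mem_iUnion.2 ⟨-n, _, ⟨value M (fun j => tail n a (j + n)), ?_, rfl⟩, ?_⟩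
    · refine ⟨_, _, ⟨h.isExpansion_value ((h.isDigitSeq_tail has n).shift n), fun j hj => ?_⟩,
        ⟨h.isExpansion_iff.2 ⟨(h.isDigitSeq_tail hbs n).shift n, ?_⟩, fun j hj => ?_⟩, ?_⟩
      · simp [tail, hj]
      · rw [h.value_shift (h.isDigitSeq_tail hbs n), h.value_shift (h.isDigitSeq_tail has n), hta]
      · simp [tail, hj]
      · simp only [tail]
        rw [if_neg (by omega), if_neg (by omega)]
        have : 1 + n = i := by omega
        rwa [this]
    · dsimp only
      rw [h.value_shift (h.isDigitSeq_tail has n), h.value_shift (h.isDigitSeq_trunc has n),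
        ← Matrix.mulVec_add, h.mulVec_zpow_add, neg_add_cancel, zpow_zero, Matrix.one_mulVec,
        add_comm, ← hva, ha.value_eq]

lemma XZero_subset_XPlus : XZero M D ⊆ XPlus M D := fun _ ⟨a, ha⟩ => ⟨a, ha.1⟩

lemma X_subset_XPlus : X M D ⊆ XPlus M D := by
  rintro x (hx | hx)
  exacts [hx.1, XZero_subset_XPlus hx]

lemma isExpansion_digits {x : Fin d → ℝ} (hx : x ∈ XPlus M D) :
    IsExpansion M D x (digits M D x) := by
  unfold digits
  split_ifs with h1 h2
  · exact h1.choose_spec.1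
  · exact h2.choose_spec
  · exact absurd hx h2

lemma IsDigitSystem.isDigitSeq_digits (h : IsDigitSystem M D) (x : Fin d → ℝ) :
    IsDigitSeq D (digits M D x) := by
  by_cases hx : x ∈ XPlus M D
  · exact (isExpansion_digits hx).isDigitSeq
  · have h1 : ¬ ∃ a, IsFiniteExpansion M D x a := fun h' => hx (XZero_subset_XPlus h')
    have h2 : ¬ ∃ a, IsExpansion M D x a := hx
    rw [digits, dif_neg h1, dif_neg h2]
    exact h.isDigitSeq_zero

/-- Almost every vector lies in a cylinder set if and only if it has the digits prescribed by it. -/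
lemma IsDigitSystem.ae_mem_cylinder_iff (h : IsDigitSystem M D) :
    ∀ᵐ x : Fin d → ℝ, ∀ n a, x ∈ cylinder M D n a ↔
      x ∈ XPlus M D ∧ ∀ j ≤ n, digits M D x j = a j := by
  filter_upwards [h.ae_notMem] with x hx n a
  constructor
  · rintro ⟨b, hb, hba⟩
    have hxp : x ∈ XPlus M D := ⟨b, hb⟩
    rw [h.expansion_unique hx.1 (isExpansion_digits hxp) hb]
    exact ⟨hxp, hba⟩
  · rintro ⟨hxp, hd⟩
    exact ⟨_, isExpansion_digits hxp, hd⟩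

lemma IsDigitSystem.ae_mem_X_iff (h : IsDigitSystem M D) :
    ∀ᵐ x : Fin d → ℝ, x ∈ X M D ↔ x ∈ XPlus M D := by
  filter_upwards [h.ae_notMem] with x hx
  exact ⟨fun h' => X_subset_XPlus h', fun h' => Or.inl ⟨h', hx.1⟩⟩

lemma IsDigitSystem.X_ae_eq (h : IsDigitSystem M D) : X M D =ᵐ[volume] XPlus M D := by
  filter_upwards [h.ae_mem_X_iff] with x hx
  exact propext hx

lemma IsDigitSystem.U_ae_eq (h : IsDigitSystem M D) : U M D =ᵐ[volume] cylinder M D 0 0 := by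
  filter_upwards [h.ae_mem_X_iff, h.ae_mem_cylinder_iff] with x hx hc
  refine propext ?_
  change (x ∈ X M D ∧ ∀ j ≤ 0, digits M D x j = 0) ↔ x ∈ cylinder M D 0 0
  rw [hx, hc]
  rfl

lemma IsDigitSystem.powImage_U_ae_eq (h : IsDigitSystem M D) (n : ℤ) :
    powImage M n (U M D) =ᵐ[volume] cylinder M D (-n) 0 := by
  have h1 : cylinder M D (-n) 0 = powL M n '' cylinder M D 0 0 := by
    rw [h.cylinder_eq (-n) h.isDigitSeq_zero]
    have : trunc (-n) (0 : ℤ → Fin d → ℤ) = 0 := by funext j; simp [trunc]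
    rw [this]
    have hv : value M (0 : ℤ → Fin d → ℤ) = 0 := by simp [value, realVec_zero]
    simp [hv]
  have h2 : powImage M n (U M D) = powL M n '' U M D := rfl
  have hinj : Function.Injective (powL M n) := Matrix.mulVec_injective_of_isUnit
    ((Matrix.isUnit_iff_isUnit_det _).2 (h.isUnit_det.det_zpow n))
  have h3 := ae_eq_set.1 h.U_ae_eq
  rw [h1, h2, ae_eq_set, ← Set.image_sdiff hinj, ← Set.image_sdiff hinj, h.volume_image_powL,
    h.volume_image_powL, h3.1, h3.2]
  simp

lemma XPlus_eq_iUnion :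
    XPlus M D = ⋃ l : ℕ, cylinder M D (-(l : ℤ)) 0 := by
  ext x
  simp only [Set.mem_iUnion]
  constructor
  · rintro ⟨a, ha⟩
    obtain ⟨N, hN⟩ := ha.isDigitSeq.vanish
    exact ⟨N.natAbs, a, ha, fun j hj => hN j (by omega)⟩
  · rintro ⟨l, a, ha, -⟩
    exact ⟨a, ha⟩

lemma IsDigitSystem.measurableSet_XPlus (h : IsDigitSystem M D) : MeasurableSet (XPlus M D) := by
  rw [XPlus_eq_iUnion]
  exact MeasurableSet.iUnion fun l => h.measurableSet_cylinder _ h.isDigitSeq_zero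

/-! ### Characters of `ℤ^d / Mℤ^d` -/

/-- The pairing `exp(2πi ⟨M⁻¹ a, b⟩)` of `ℤ^d / Mℤ^d` and `ℤ^d / Mᵀℤ^d`. -/
noncomputable def digitChar (M : Matrix (Fin d) (Fin d) ℤ) (a b : Fin d → ℤ) : ℂ :=
  Complex.exp (2 * Real.pi * Complex.I * (((realMat M)⁻¹ *ᵥ realVec a) ⬝ᵥ realVec b : ℝ))

lemma norm_exp_two_pi_I_mul (t : ℝ) : ‖Complex.exp (2 * Real.pi * Complex.I * (t : ℂ))‖ = 1 := by
  have : 2 * Real.pi * Complex.I * (t : ℂ) = ((2 * Real.pi * t : ℝ) : ℂ) * Complex.I := by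
    push_cast; ring
  rw [this, Complex.norm_exp_ofReal_mul_I]

lemma mul_conj_eq_one_of_norm {z : ℂ} (hz : ‖z‖ = 1) : z * starRingEnd ℂ z = 1 := by
  rw [Complex.mul_conj, Complex.normSq_eq_norm_sq, hz]; simp

lemma norm_digitChar (a b : Fin d → ℤ) : ‖digitChar M a b‖ = 1 := norm_exp_two_pi_I_mul _

lemma digitChar_add_left (a a' b : Fin d → ℤ) :
    digitChar M (a + a') b = digitChar M a b * digitChar M a' b := by
  rw [digitChar, digitChar, digitChar, ← Complex.exp_add, realVec_add, Matrix.mulVec_add,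
    add_dotProduct]
  push_cast
  ring_nf

lemma digitChar_transpose (a b : Fin d → ℤ) : digitChar Mᵀ b a = digitChar M a b := by
  have : realMat Mᵀ = (realMat M)ᵀ := rfl
  rw [digitChar, digitChar, this, ← Matrix.transpose_nonsing_inv, Matrix.mulVec_transpose,
    ← Matrix.dotProduct_mulVec, dotProduct_comm]

lemma digitChar_add_right (a b b' : Fin d → ℤ) :
    digitChar M a (b + b') = digitChar M a b * digitChar M a b' := by
  simp only [← digitChar_transpose (M := M) a, digitChar_add_left]

lemma digitChar_mul_conj (a b b' : Fin d → ℤ) :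
    digitChar M a b * starRingEnd ℂ (digitChar M a b') = digitChar M a (b - b') := by
  have h1 : digitChar M a b = digitChar M a (b - b') * digitChar M a b' := by
    rw [← digitChar_add_right, sub_add_cancel]
  rw [h1, mul_assoc, mul_conj_eq_one_of_norm (norm_digitChar _ _), mul_one]

lemma digitChar_eq_one_iff (a b : Fin d → ℤ) : digitChar M a b = 1 ↔
    ∃ n : ℤ, ((realMat M)⁻¹ *ᵥ realVec a) ⬝ᵥ realVec b = n := by
  rw [digitChar, Complex.exp_eq_one_iff]
  have h0 : (2 * Real.pi * Complex.I : ℂ) ≠ 0 := Complex.two_pi_I_ne_zero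
  refine exists_congr fun n => ?_
  rw [mul_comm (n : ℂ), mul_right_inj' h0]
  exact_mod_cast Iff.rfl

lemma IsDigitSystem.digitChar_mulVec (h : IsDigitSystem M D) (s b : Fin d → ℤ) :
    digitChar M (M *ᵥ s) b = 1 := by
  rw [digitChar_eq_one_iff]
  refine ⟨s ⬝ᵥ b, ?_⟩
  rw [realVec_mulVec, Matrix.mulVec_mulVec, Matrix.nonsing_inv_mul _ h.isUnit_det,
    Matrix.one_mulVec]
  simp [realVec, dotProduct]

/-- A vector inducing the trivial character lies in `Mᵀℤ^d`. -/
lemma IsDigitSystem.exists_of_digitChar_eq_one (h : IsDigitSystem M D) {b : Fin d → ℤ}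
    (hb : ∀ a, digitChar M a b = 1) : ∃ s : Fin d → ℤ, b = Mᵀ *ᵥ s := by
  choose s hs using fun i => (digitChar_eq_one_iff (M := M) _ _).1 (hb (Pi.single i 1))
  refine ⟨s, realVec_injective ?_⟩
  have h1 : realVec s = ((realMat M)⁻¹)ᵀ *ᵥ realVec b := by
    ext i
    rw [realVec, ← hs i]
    have : realVec (Pi.single i (1 : ℤ)) = Pi.single i (1 : ℝ) := by
      ext j
      rcases eq_or_ne j i with rfl | hj
      · simp [realVec]
      · simp [realVec, hj]
    rw [this, Matrix.mulVec_single_one]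
    rfl
  have h2 : realMat Mᵀ = (realMat M)ᵀ := rfl
  rw [realVec_mulVec, h1, h2, Matrix.mulVec_mulVec, ← Matrix.transpose_mul,
    Matrix.nonsing_inv_mul _ h.isUnit_det, Matrix.transpose_one, Matrix.one_mulVec]

/-- The sum of a nontrivial character over a complete residue system vanishes, because the sum is
invariant under translations. -/
lemma IsDigitSystem.sum_digitChar_eq_zero (h : IsDigitSystem M D) {b : Fin d → ℤ}
    (hb : ¬ ∃ s : Fin d → ℤ, b = Mᵀ *ᵥ s) : ∑ a ∈ D, digitChar M a b = 0 := by
  by_contra hS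
  refine hb (h.exists_of_digitChar_eq_one fun t => ?_)
  choose r hrD s hs using fun a : Fin d → ℤ => h.exists_residue (a + t)
  have hval : ∀ a, digitChar M (r a) b = digitChar M a b * digitChar M t b := fun a => by
    rw [← digitChar_add_left, hs a, digitChar_add_left, h.digitChar_mulVec, mul_one]
  have hinj : Set.InjOn r D := by
    intro a ha a' ha' haa
    by_contra hne
    refine h.digitSet.incongruent a ha a' ha' hne ⟨s a - s a', ?_⟩
    have h1 := hs a
    have h2 := hs a'
    rw [haa] at h1
    rw [Matrix.mulVec_sub]
    have h3 : a - a' = (a + t) - (a' + t) := by abel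
    rw [h3, h1, h2]; abel
  have himg : D.image r = D :=
    Finset.eq_of_subset_of_card_le (Finset.image_subset_iff.2 fun a _ => hrD a)
      (Finset.card_image_of_injOn hinj).ge
  have hsum : ∑ a ∈ D, digitChar M a b = (∑ a ∈ D, digitChar M a b) * digitChar M t b := by
    nth_rewrite 1 [← himg]
    rw [Finset.sum_image hinj, Finset.sum_mul]
    exact Finset.sum_congr rfl fun a _ => hval a
  exact mul_left_cancel₀ hS (by rw [← hsum, mul_one])

lemma IsDigitSystem.sum_digitChar_mul_conj (h : IsDigitSystem M D) (h' : IsDigitSystem Mᵀ D')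
    {b b' : Fin d → ℤ} (hb : b ∈ D') (hb' : b' ∈ D') :
    ∑ a ∈ D, digitChar M a b * starRingEnd ℂ (digitChar M a b') =
      if b = b' then (M.det.natAbs : ℂ) else 0 := by
  split_ifs with hbb
  · subst hbb
    simp_rw [mul_conj_eq_one_of_norm (norm_digitChar _ _)]
    simp [h.digitSet.card_eq]
  · simp_rw [digitChar_mul_conj]
    exact h.sum_digitChar_eq_zero (h'.digitSet.incongruent b hb b' hb' hbb)

/-! ### Characters of finite windows of digits -/

/-- The pairing of two finite families of digits. -/
noncomputable def windowChar {ι : Type*} [Fintype ι] (M : Matrix (Fin d) (Fin d) ℤ)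
    (p q : ι → Fin d → ℤ) : ℂ := ∏ i, digitChar M (p i) (q i)

lemma windowChar_transpose {ι : Type*} [Fintype ι] (p q : ι → Fin d → ℤ) :
    windowChar Mᵀ q p = windowChar M p q :=
  Finset.prod_congr rfl fun _ _ => digitChar_transpose _ _

lemma IsDigitSystem.sum_windowChar_mul_conj {ι : Type*} [Fintype ι] [DecidableEq ι]
    (h : IsDigitSystem M D) (h' : IsDigitSystem Mᵀ D') {q q' : ι → Fin d → ℤ}
    (hq : ∀ i, q i ∈ D') (hq' : ∀ i, q' i ∈ D') :
    ∑ p ∈ Fintype.piFinset (fun _ : ι => D),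
      windowChar M p q * starRingEnd ℂ (windowChar M p q') =
      if q = q' then (M.det.natAbs : ℂ) ^ Fintype.card ι else 0 := by
  have h1 : ∀ p : ι → Fin d → ℤ, windowChar M p q * starRingEnd ℂ (windowChar M p q') =
      ∏ i, (digitChar M (p i) (q i) * starRingEnd ℂ (digitChar M (p i) (q' i))) := fun p => by
    rw [windowChar, windowChar, map_prod, Finset.prod_mul_distrib]
  simp_rw [h1]
  rw [← Finset.prod_univ_sum (fun _ : ι => D)
    (fun i a => digitChar M a (q i) * starRingEnd ℂ (digitChar M a (q' i)))]
  simp_rw [h.sum_digitChar_mul_conj h' (hq _) (hq' _)]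
  split_ifs with hqq
  · subst hqq
    simp
  · obtain ⟨i, hi⟩ := Function.ne_iff.1 hqq
    exact Finset.prod_eq_zero (Finset.mem_univ i) (if_neg hi)

/-- The pairing of two digit sequences; `chi M D D' x ω` is the pairing of the digits of `x` and
those of `ω`. -/
noncomputable def seqChar (M : Matrix (Fin d) (Fin d) ℤ) (a b : ℤ → Fin d → ℤ) : ℂ :=
  Complex.exp (2 * Real.pi * Complex.I *
    ((∑' j : ℤ, ((realMat M)⁻¹ *ᵥ realVec (a j)) ⬝ᵥ realVec (b (1 - j)) : ℝ) : ℂ))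

lemma chi_eq_seqChar (x ω : Fin d → ℝ) :
    chi M D D' x ω = seqChar M (digits M D x) (digits Mᵀ D' ω) := rfl

lemma norm_seqChar (a b : ℤ → Fin d → ℤ) : ‖seqChar M a b‖ = 1 := norm_exp_two_pi_I_mul _

lemma norm_chi (x ω : Fin d → ℝ) : ‖chi M D D' x ω‖ = 1 := norm_seqChar _ _

lemma seqChar_eq_windowChar (W : Finset ℤ) {a b : ℤ → Fin d → ℤ}
    (hW : ∀ j ∉ W, a j = 0 ∨ b (1 - j) = 0) :
    seqChar M a b = windowChar M (fun j : W => a j) (fun j : W => b (1 - j)) := by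
  have hW' : ∀ j ∉ W, ((realMat M)⁻¹ *ᵥ realVec (a j)) ⬝ᵥ realVec (b (1 - j)) = 0 := by
    intro j hj
    rcases hW j hj with h0 | h0
    · simp [h0, realVec_zero]
    · simp [h0, realVec_zero]
  rw [seqChar, tsum_eq_sum hW', windowChar]
  simp only [digitChar]
  rw [← Complex.exp_sum, ← Finset.mul_sum, Complex.ofReal_sum]
  congr 2
  exact (Finset.sum_coe_sort W fun j =>
    ((((realMat M)⁻¹ *ᵥ realVec (a j)) ⬝ᵥ realVec (b (1 - j)) : ℝ) : ℂ)).symm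

/-! ### Functions of finitely many digits -/

/-- The set of all vectors with an expansion whose digits of index at most `-l` vanish; up to a null
set this is `M^l(U)`. -/
def tile (M : Matrix (Fin d) (Fin d) ℤ) (D : Finset (Fin d → ℤ)) (l : ℕ) : Set (Fin d → ℝ) :=
  cylinder M D (-(l : ℤ)) 0

/-- The set of the indices `-l < j ≤ n`. -/
noncomputable abbrev window (l n : ℕ) : Finset ℤ := Finset.Ioc (-(l : ℤ)) (n : ℤ)

/-- The digit sequence which has the entries of `p` on `W` and vanishes elsewhere. -/
def fill (W : Finset ℤ) (p : W → Fin d → ℤ) : ℤ → Fin d → ℤ :=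
  fun j => if hj : j ∈ W then p ⟨j, hj⟩ else 0

/-- The digits of index `-l < j ≤ n`. -/
noncomputable def windowDigits (M : Matrix (Fin d) (Fin d) ℤ) (D : Finset (Fin d → ℤ)) (l n : ℕ)
    (x : Fin d → ℝ) : window l n → Fin d → ℤ :=
  fun j => digits M D x j

lemma IsDigitSystem.isDigitSeq_fill (h : IsDigitSystem M D) (l n : ℕ)
    {p : window l n → Fin d → ℤ} (hp : ∀ j, p j ∈ D) :
    IsDigitSeq D (fill _ p) := by
  refine ⟨fun j => ?_, -l, fun j hj => ?_⟩
  · unfold fill; split_ifs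
    exacts [hp _, h.digitSet.zero_mem]
  · unfold fill
    rw [dif_neg]
    simp; omega

lemma IsDigitSystem.measurableSet_tile (h : IsDigitSystem M D) (l : ℕ) :
    MeasurableSet (tile M D l) := h.measurableSet_cylinder _ h.isDigitSeq_zero

lemma IsDigitSystem.isFiniteMeasure_tile (h : IsDigitSystem M D) (l : ℕ) :
    IsFiniteMeasure (volume.restrict (tile M D l)) :=
  ⟨by
    rw [Measure.restrict_apply_univ]
    exact (h.isCompact_cylinder _ h.isDigitSeq_zero).measure_lt_top⟩

lemma IsDigitSystem.ae_digits_eq_zero_of_tile (h : IsDigitSystem M D) (l : ℕ) :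
    ∀ᵐ x ∂volume.restrict (tile M D l), ∀ j ≤ -(l : ℤ), digits M D x j = 0 := by
  rw [ae_restrict_iff' (h.measurableSet_tile l)]
  filter_upwards [h.ae_mem_cylinder_iff] with x hx hxt
  exact ((hx _ _).1 hxt).2

/-- A function of the digits in a window is a combination of indicator functions of cylinder
sets. -/
lemma IsDigitSystem.ae_eq_sum_indicator (h : IsDigitSystem M D) (l n : ℕ)
    (G : (window l n → Fin d → ℤ) → ℂ) :
    (fun x => G (windowDigits M D l n x)) =ᵐ[volume.restrict (tile M D l)]
      fun x => ∑ p ∈ Fintype.piFinset (fun _ : window l n => D),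
        (cylinder M D n (fill _ p)).indicator (fun _ => G p) x := by
  rw [Filter.EventuallyEq, ae_restrict_iff' (h.measurableSet_tile l)]
  filter_upwards [h.ae_mem_cylinder_iff] with x hx hxt
  obtain ⟨hxp, hx0⟩ := (hx _ _).1 hxt
  have hmem : ∀ p : window l n → Fin d → ℤ,
      x ∈ cylinder M D n (fill _ p) ↔ windowDigits M D l n x = p := by
    intro p
    rw [hx]
    constructor
    · rintro ⟨-, hd⟩
      funext j
      have h1 := (Finset.mem_Ioc.1 j.2)
      rw [windowDigits, hd j h1.2, fill, dif_pos j.2]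
    · rintro rfl
      refine ⟨hxp, fun j hj => ?_⟩
      unfold fill
      split_ifs with hjW
      · rfl
      · refine hx0 j ?_
        by_contra hlt
        exact hjW (Finset.mem_Ioc.2 ⟨by omega, hj⟩)
  rw [Finset.sum_eq_single (windowDigits M D l n x)]
  · rw [Set.indicator_of_mem ((hmem _).2 rfl)]
  · intro p _ hp
    rw [Set.indicator_of_notMem]
    exact fun h' => hp ((hmem p).1 h').symm
  · intro hp
    exact absurd (Fintype.mem_piFinset.2 fun _ => (h.isDigitSeq_digits x).mem _) hp

lemma IsDigitSystem.aestronglyMeasurable_window (h : IsDigitSystem M D) (l n : ℕ)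
    (G : (window l n → Fin d → ℤ) → ℂ) :
    AEStronglyMeasurable (fun x => G (windowDigits M D l n x)) (volume.restrict (tile M D l)) := by
  refine AEStronglyMeasurable.congr ?_ (h.ae_eq_sum_indicator l n G).symm
  refine Finset.aestronglyMeasurable_fun_sum _ fun p hp => ?_
  exact (stronglyMeasurable_const.indicator (h.measurableSet_cylinder _
    (h.isDigitSeq_fill l n (Fintype.mem_piFinset.1 hp)))).aestronglyMeasurable

lemma IsDigitSystem.volume_real_cylinder (h : IsDigitSystem M D) (n : ℤ) {a : ℤ → Fin d → ℤ}
    (ha : IsDigitSeq D a) :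
    volume.real (cylinder M D n a) =
      (M.det.natAbs : ℝ) ^ (-n) * volume.real (cylinder M D 0 0) := by
  rw [Measure.real, h.volume_cylinder n ha, ENNReal.toReal_mul, ← ENNReal.rpow_intCast,
    ← ENNReal.toReal_rpow, ENNReal.toReal_natCast, Real.rpow_intCast]
  rfl

/-- The digits in a window are equidistributed. -/
lemma IsDigitSystem.integral_window (h : IsDigitSystem M D) (l n : ℕ)
    (G : (window l n → Fin d → ℤ) → ℂ) :
    ∫ x in tile M D l, G (windowDigits M D l n x) =
      (((M.det.natAbs : ℝ) ^ (-(n : ℤ)) * volume.real (cylinder M D 0 0) : ℝ) : ℂ) *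
        ∑ p ∈ Fintype.piFinset (fun _ : window l n => D), G p := by
  have := h.isFiniteMeasure_tile l
  rw [integral_congr_ae (h.ae_eq_sum_indicator l n G), integral_finsetSum, Finset.mul_sum]
  · refine Finset.sum_congr rfl fun p hp => ?_
    have hp' := h.isDigitSeq_fill l n (Fintype.mem_piFinset.1 hp)
    have hsub : cylinder M D n (fill _ p) ⊆ tile M D l := by
      refine cylinder_mono (by omega) fun j hj => ?_
      unfold fill
      rw [dif_neg]
      · rfl
      · simp; omega
    rw [integral_indicator (h.measurableSet_cylinder _ hp'), setIntegral_const,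
      measureReal_restrict_apply (h.measurableSet_cylinder _ hp'), Set.inter_eq_left.2 hsub,
      h.volume_real_cylinder _ hp', Complex.real_smul]
  · intro p hp
    exact (integrable_const _).indicator (h.measurableSet_cylinder _
      (h.isDigitSeq_fill l n (Fintype.mem_piFinset.1 hp)))

lemma IsDigitSystem.ae_seqChar_eq_windowChar (h : IsDigitSystem M D) (l n : ℕ)
    {b : ℤ → Fin d → ℤ} (hb : ∀ i ≤ -(n : ℤ), b i = 0) :
    (fun x => seqChar M (digits M D x) b) =ᵐ[volume.restrict (tile M D l)]
      fun x => windowChar M (windowDigits M D l n x)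
        (fun j : window l n => b (1 - j)) := by
  filter_upwards [h.ae_digits_eq_zero_of_tile l] with x hx
  refine seqChar_eq_windowChar _ fun j hj => ?_
  rcases le_or_gt j (-(l : ℤ)) with hjl | hjl
  · exact Or.inl (hx j hjl)
  · right
    refine hb _ ?_
    by_contra hlt
    exact hj (Finset.mem_Ioc.2 ⟨hjl, by omega⟩)

lemma IsDigitSeq.exists_nat_vanish {b : ℤ → Fin d → ℤ} (hb : IsDigitSeq D b) :
    ∃ n : ℕ, ∀ i ≤ -(n : ℤ), b i = 0 := by
  obtain ⟨N, hN⟩ := hb.vanish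
  exact ⟨N.natAbs, fun i hi => hN i (by omega)⟩

lemma IsDigitSystem.aestronglyMeasurable_seqChar (h : IsDigitSystem M D) (l : ℕ)
    {b : ℤ → Fin d → ℤ} (hb : IsDigitSeq D' b) :
    AEStronglyMeasurable (fun x => seqChar M (digits M D x) b) (volume.restrict (tile M D l)) := by
  obtain ⟨n, hn⟩ := hb.exists_nat_vanish
  exact (h.aestronglyMeasurable_window l n fun p => windowChar M p _).congr
    (h.ae_seqChar_eq_windowChar l n hn).symm

/-! ### Orthogonality and completeness of the characters on a tile -/

/-- The digit sequences with digits in `D'` and without digits of index bigger than `l`. They index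
a complete orthogonal system of characters `x ↦ seqChar M (digits M D x) b` on `tile M D l`. -/
abbrev TileIndex (D' : Finset (Fin d → ℤ)) (l : ℕ) : Type :=
  {b : ℤ → Fin d → ℤ // IsDigitSeq D' b ∧ ∀ i > (l : ℤ), b i = 0}

instance (l : ℕ) : Countable (TileIndex D' l) := by
  have hfin : ∀ b : TileIndex D' l, (Function.support b.1).Finite := fun b => by
    obtain ⟨N, hN⟩ := b.2.1.vanish
    refine (Set.finite_Icc N l).subset fun i hi => ⟨?_, ?_⟩
    · by_contra hlt
      exact hi (hN i (by omega))
    · by_contra hlt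
      exact hi (b.2.2 i (by omega))
  refine Function.Injective.countable (f := fun b => Finsupp.ofSupportFinite b.1 (hfin b)) ?_
  intro b b' hbb
  exact Subtype.ext (congrArg (fun p : ℤ →₀ (Fin d → ℤ) => (p : ℤ → Fin d → ℤ)) hbb)

lemma IsDigitSystem.integral_seqChar_mul_conj (h : IsDigitSystem M D) (h' : IsDigitSystem Mᵀ D')
    (l : ℕ) (b b' : TileIndex D' l) :
    ∫ x in tile M D l, seqChar M (digits M D x) b.1 *
        starRingEnd ℂ (seqChar M (digits M D x) b'.1) =
      open Classical in
      if b = b' then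
        (((M.det.natAbs : ℝ) ^ l * volume.real (cylinder M D 0 0) : ℝ) : ℂ) else 0 := by
  classical
  obtain ⟨n₁, hn₁⟩ := b.2.1.exists_nat_vanish
  obtain ⟨n₂, hn₂⟩ := b'.2.1.exists_nat_vanish
  -- Outside the window of the indices `-l < j ≤ n` the digits do not contribute to the characters.
  set n := max n₁ n₂ with hn
  have hb : ∀ i ≤ -(n : ℤ), b.1 i = 0 := fun i hi => hn₁ i (by omega)
  have hb' : ∀ i ≤ -(n : ℤ), b'.1 i = 0 := fun i hi => hn₂ i (by omega)
  have hcongr : (fun x => seqChar M (digits M D x) b.1 *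
      starRingEnd ℂ (seqChar M (digits M D x) b'.1)) =ᵐ[volume.restrict (tile M D l)]
      fun x => (fun p => windowChar M p (fun j : window l n => b.1 (1 - j)) *
        starRingEnd ℂ (windowChar M p (fun j : window l n => b'.1 (1 - j))))
          (windowDigits M D l n x) := by
    filter_upwards [h.ae_seqChar_eq_windowChar l n hb, h.ae_seqChar_eq_windowChar l n hb']
      with x h1 h2
    rw [h1, h2]
  rw [integral_congr_ae hcongr, h.integral_window l n (fun p => windowChar M p _ *
    starRingEnd ℂ (windowChar M p _)),
    h.sum_windowChar_mul_conj h' (fun j => b.2.1.mem _) (fun j => b'.2.1.mem _)]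
  have hiff : ((fun j : window l n => b.1 (1 - j)) =
      fun j : window l n => b'.1 (1 - j)) ↔ b = b' := by
    refine ⟨fun heq => Subtype.ext (funext fun i => ?_), fun heq => by rw [heq]⟩
    rcases le_or_gt i (-(n : ℤ)) with hi | hi
    · rw [hb i hi, hb' i hi]
    · rcases le_or_gt i l with hil | hil
      · have := congrFun heq ⟨1 - i, Finset.mem_Ioc.2 ⟨by omega, by omega⟩⟩
        simpa using this
      · rw [b.2.2 i hil, b'.2.2 i hil]
  simp only [hiff]
  split_ifs
  · have hm : (M.det.natAbs : ℂ) ≠ 0 := by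
      exact_mod_cast (Int.natAbs_pos.2 h.det_ne_zero).ne'
    have hcard : Fintype.card (window l n) = n + l := by
      rw [Fintype.card_coe, Int.card_Ioc]; omega
    rw [hcard]
    push_cast
    rw [zpow_neg, zpow_natCast, pow_add]
    field_simp
  · simp

lemma IsDigitSystem.isDigitSeq_fill_reflect (h : IsDigitSystem M D) (l n : ℕ)
    {q : window l n → Fin d → ℤ} (hq : ∀ j, q j ∈ D) :
    IsDigitSeq D (fun i => fill _ q (1 - i)) ∧ (∀ i > (l : ℤ), fill _ q (1 - i) = 0) ∧
      ∀ i ≤ -(n : ℤ), fill _ q (1 - i) = 0 := by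
  have h1 : ∀ i ≤ -(n : ℤ), fill _ q (1 - i) = 0 := fun i hi => by
    unfold fill; rw [dif_neg]; simp; omega
  refine ⟨⟨fun i => (h.isDigitSeq_fill l n hq).mem _, -n, h1⟩, fun i hi => ?_, h1⟩
  unfold fill; rw [dif_neg]; simp; omega

lemma IsDigitSystem.integrable_mul_conj_seqChar (h : IsDigitSystem M D) (l : ℕ)
    {f : (Fin d → ℝ) → ℂ} (hf : IntegrableOn f (tile M D l)) {b : ℤ → Fin d → ℤ}
    (hb : IsDigitSeq D' b) :
    IntegrableOn (fun x => f x * starRingEnd ℂ (seqChar M (digits M D x) b)) (tile M D l) := by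
  refine hf.mul_bdd (c := 1) ?_ (ae_of_all _ fun x => ?_)
  · exact Complex.continuous_conj.comp_aestronglyMeasurable (h.aestronglyMeasurable_seqChar l hb)
  · rw [RCLike.norm_conj, norm_seqChar]

/-- A function orthogonal to all characters is orthogonal to all functions of finitely many digits,
by Fourier inversion on the finite group of digits in a window. -/
lemma IsDigitSystem.integral_mul_window_eq_zero (h : IsDigitSystem M D) (h' : IsDigitSystem Mᵀ D')
    (l : ℕ) {f : (Fin d → ℝ) → ℂ} (hf : IntegrableOn f (tile M D l))
    (horth : ∀ b : TileIndex D' l,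
      ∫ x in tile M D l, f x * starRingEnd ℂ (seqChar M (digits M D x) b.1) = 0)
    (n : ℕ) (G : (window l n → Fin d → ℤ) → ℂ) :
    ∫ x in tile M D l, f x * G (windowDigits M D l n x) = 0 := by
  classical
  set m : ℂ := (M.det.natAbs : ℂ) with hmdef
  have hm : m ≠ 0 := by
    rw [hmdef]; exact_mod_cast (Int.natAbs_pos.2 h.det_ne_zero).ne'
  -- The orthogonality relations for `Mᵀ` are the dual ones for `M`; they give Fourier inversion.
  have h'' : IsDigitSystem Mᵀᵀ D := h
  have hinv : ∀ p ∈ Fintype.piFinset (fun _ : window l n => D), G p =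
      ∑ p' ∈ Fintype.piFinset (fun _ : window l n => D),
        ∑ q ∈ Fintype.piFinset (fun _ : window l n => D'),
          G p' * (m ^ Fintype.card (window l n))⁻¹ * windowChar M p' q *
            starRingEnd ℂ (windowChar M p q) := by
    intro p hp
    have h1 : ∀ p' ∈ Fintype.piFinset (fun _ : window l n => D),
        ∑ q ∈ Fintype.piFinset (fun _ : window l n => D'),
          G p' * (m ^ Fintype.card (window l n))⁻¹ *
          windowChar M p' q * starRingEnd ℂ (windowChar M p q) = if p' = p then G p else 0 := by
      intro p' hp'
      have h2 := h'.sum_windowChar_mul_conj h'' (Fintype.mem_piFinset.1 hp')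
        (Fintype.mem_piFinset.1 hp)
      simp only [windowChar_transpose, Matrix.det_transpose] at h2
      simp_rw [mul_assoc]
      rw [← Finset.mul_sum, ← Finset.mul_sum, h2]
      split_ifs with hpp
      · rw [hpp, inv_mul_cancel₀ (pow_ne_zero _ hm), mul_one]
      · simp
    rw [Finset.sum_congr rfl h1]
    simp [hp]
  have hcongr : (fun x => f x * G (windowDigits M D l n x)) =ᵐ[volume.restrict (tile M D l)]
      fun x => ∑ p' ∈ Fintype.piFinset (fun _ : window l n => D),
        ∑ q ∈ Fintype.piFinset (fun _ : window l n => D'),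
          (G p' * (m ^ Fintype.card (window l n))⁻¹ * windowChar M p' q) *
            (f x * starRingEnd ℂ (seqChar M (digits M D x) fun i => fill _ q (1 - i))) := by
    have hall : ∀ᵐ x ∂volume.restrict (tile M D l),
        ∀ q ∈ Fintype.piFinset (fun _ : window l n => D'),
        seqChar M (digits M D x) (fun i => fill _ q (1 - i)) =
          windowChar M (windowDigits M D l n x) q := by
      refine (ae_ball_iff (Finset.countable_toSet _)).2 fun q hq => ?_
      have hq' := h'.isDigitSeq_fill_reflect l n (Fintype.mem_piFinset.1 hq)
      filter_upwards [h.ae_seqChar_eq_windowChar l n hq'.2.2] with x hx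
      rw [hx]
      congr 1
      funext j
      simp only [sub_sub_cancel]
      unfold fill
      rw [dif_pos j.2]
    filter_upwards [hall] with x hx
    rw [hinv (windowDigits M D l n x)
      (Fintype.mem_piFinset.2 fun _ => (h.isDigitSeq_digits x).mem _), Finset.mul_sum]
    refine Finset.sum_congr rfl fun p' _ => ?_
    rw [Finset.mul_sum]
    refine Finset.sum_congr rfl fun q hq => ?_
    rw [hx q hq]
    ring
  have hint : ∀ q ∈ Fintype.piFinset (fun _ : window l n => D'), IntegrableOn (fun x => f x *
      starRingEnd ℂ (seqChar M (digits M D x) fun i => fill _ q (1 - i))) (tile M D l) :=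
    fun q hq => h.integrable_mul_conj_seqChar l hf
      (h'.isDigitSeq_fill_reflect l n (Fintype.mem_piFinset.1 hq)).1
  rw [integral_congr_ae hcongr, integral_finsetSum]
  · refine Finset.sum_eq_zero fun p' _ => ?_
    rw [integral_finsetSum _ fun q hq => (hint q hq).const_mul _]
    refine Finset.sum_eq_zero fun q hq => ?_
    have hq' := h'.isDigitSeq_fill_reflect l n (Fintype.mem_piFinset.1 hq)
    rw [integral_const_mul, horth ⟨_, hq'.1, hq'.2.1⟩, mul_zero]
  · exact fun p' _ => integrable_finsetSum _ fun q hq => (hint q hq).const_mul _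

/-- Completeness of the characters on a tile: a function orthogonal to all characters is orthogonal
to all test functions `g`, as `g` is the limit of its values at the truncated expansions. -/
lemma IsDigitSystem.ae_eq_zero_of_orthogonal (h : IsDigitSystem M D) (h' : IsDigitSystem Mᵀ D')
    (l : ℕ) {f : (Fin d → ℝ) → ℂ} (hf : IntegrableOn f (tile M D l))
    (horth : ∀ b : TileIndex D' l,
      ∫ x in tile M D l, f x * starRingEnd ℂ (seqChar M (digits M D x) b.1) = 0) :
    f =ᵐ[volume.restrict (tile M D l)] 0 := by
  refine ae_eq_zero_of_integral_contDiff_smul_eq_zero hf.locallyIntegrable fun g hg hgs => ?_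
  obtain ⟨C, hC⟩ := hg.continuous.bounded_above_of_compact_support hgs
  let F : ℕ → (Fin d → ℝ) → ℂ := fun n x =>
    f x * (g (value M (fill _ (windowDigits M D l n x))) : ℂ)
  have hFzero : ∀ n, ∫ x in tile M D l, F n x = 0 := fun n =>
    h.integral_mul_window_eq_zero h' l hf horth n fun p => (g (value M (fill _ p)) : ℂ)
  have hlim : Tendsto (fun n => ∫ x in tile M D l, F n x) atTop
      (𝓝 (∫ x in tile M D l, g x • f x)) := by
    refine tendsto_integral_of_dominated_convergence (fun x => ‖f x‖ * C)
      (fun n => hf.aestronglyMeasurable.mul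
        (h.aestronglyMeasurable_window l n fun p => (g (value M (fill _ p)) : ℂ)))
      (hf.norm.mul_const C) (fun n => ae_of_all _ fun x => ?_) ?_
    · rw [norm_mul, Complex.norm_real]
      exact mul_le_mul_of_nonneg_left (hC _) (norm_nonneg _)
    · filter_upwards [h.ae_digits_eq_zero_of_tile l, ae_restrict_mem (h.measurableSet_tile l)]
        with x hx0 hxt
      have hexp : IsExpansion M D x (digits M D x) := by
        obtain ⟨b, hb, -⟩ := hxt
        exact isExpansion_digits ⟨b, hb⟩
      have htr : ∀ n : ℕ, fill _ (windowDigits M D l n x) = trunc n (digits M D x) := by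
        intro n
        funext j
        unfold fill trunc windowDigits
        by_cases hj : j ≤ n
        · by_cases hjl : j ≤ -(l : ℤ)
          · rw [dif_neg (by simp; omega), if_pos hj, hx0 j hjl]
          · rw [dif_pos (Finset.mem_Ioc.2 ⟨by omega, hj⟩), if_pos hj]
        · rw [dif_neg (by simp; omega), if_neg hj]
      have h1 := h.tendsto_value_trunc hexp.isDigitSeq
      rw [hexp.value_eq] at h1
      have h2 : Tendsto (fun n : ℕ => (g (value M (trunc n (digits M D x))) : ℂ)) atTop
          (𝓝 (g x : ℂ)) :=
        ((Complex.continuous_ofReal.comp hg.continuous).tendsto x).comp h1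
      have h3 := h2.const_mul (f x)
      simp only [F, htr, Complex.real_smul]
      rwa [mul_comm (g x : ℂ)]
  simp only [hFzero] at hlim
  exact (tendsto_nhds_unique hlim tendsto_const_nhds)

/-! ### Parseval's identity on a tile -/

section General

variable {α : Type*} [MeasurableSpace α] {μ : Measure α}

lemma inner_toLp_toLp {f g : α → ℂ} (hf : MemLp f 2 μ) (hg : MemLp g 2 μ) :
    inner ℂ (hg.toLp g) (hf.toLp f) = ∫ x, f x * starRingEnd ℂ (g x) ∂μ := by
  rw [L2.inner_def]
  refine integral_congr_ae ?_
  filter_upwards [hf.coeFn_toLp, hg.coeFn_toLp] with x h1 h2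
  rw [h1, h2]
  rfl

/-- Parseval's identity for a complete orthogonal system whose elements have norm `√K`. -/
lemma hasSum_sq_norm_integral_mul_conj {ι : Type*} [DecidableEq ι] {e : ι → α → ℂ}
    (he : ∀ i, MemLp (e i) 2 μ) {K : ℝ} (hK : 0 < K)
    (horth : ∀ i j, ∫ x, e i x * starRingEnd ℂ (e j x) ∂μ = if i = j then (K : ℂ) else 0)
    (hcompl : ∀ f : α → ℂ, MemLp f 2 μ → (∀ i, ∫ x, f x * starRingEnd ℂ (e i x) ∂μ = 0) →
      f =ᵐ[μ] 0)
    {f : α → ℂ} (hf : MemLp f 2 μ) :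
    HasSum (fun i => ‖∫ x, f x * starRingEnd ℂ (e i x) ∂μ‖ ^ 2) (K * ‖hf.toLp f‖ ^ 2) := by
  set s : ℂ := (((√K)⁻¹ : ℝ) : ℂ) with hs
  have hsK : s * s * K = 1 := by
    rw [hs, ← Complex.ofReal_mul, ← Complex.ofReal_mul, ← mul_inv, Real.mul_self_sqrt hK.le,
      inv_mul_cancel₀ hK.ne', Complex.ofReal_one]
  have hsc : starRingEnd ℂ s = s := Complex.conj_ofReal _
  have hs0 : s ≠ 0 := by
    rintro h0
    simp [h0] at hsK
  -- The normalized system is a Hilbert basis.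
  let v : ι → Lp ℂ 2 μ := fun i => s • (he i).toLp (e i)
  have hinner : ∀ i (g : α → ℂ) (hg : MemLp g 2 μ),
      inner ℂ (v i) (hg.toLp g) = s * ∫ x, g x * starRingEnd ℂ (e i x) ∂μ := by
    intro i g hg
    rw [inner_smul_left, inner_toLp_toLp, hsc]
  have hon : Orthonormal ℂ v := by
    rw [orthonormal_iff_ite]
    intro i j
    simp only [v]
    rw [inner_smul_left, inner_smul_right, inner_toLp_toLp, horth, hsc]
    by_cases hij : i = j
    · rw [if_pos hij.symm, if_pos hij, ← mul_assoc, hsK]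
    · rw [if_neg (Ne.symm hij), if_neg hij]; simp
  have hbot : (Submodule.span ℂ (Set.range v))ᗮ = ⊥ := by
    rw [Submodule.eq_bot_iff]
    intro g hg
    have h1 : ∀ i, inner ℂ (v i) g = 0 := fun i =>
      (Submodule.mem_orthogonal _ _).1 hg _ (Submodule.subset_span ⟨i, rfl⟩)
    have hgm := Lp.memLp g
    have hgt : hgm.toLp g = g := Lp.toLp_coeFn g hgm
    have h2 := hcompl g hgm fun i => by
      have h3 := h1 i
      rw [← hgt, hinner i g hgm] at h3
      exact (mul_eq_zero.1 h3).resolve_left hs0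
    exact (Lp.eq_zero_iff_ae_eq_zero).2 h2
  have hsum := (HilbertBasis.mkOfOrthogonalEqBot hon hbot).hasSum_inner_mul_inner
    (hf.toLp f) (hf.toLp f)
  rw [HilbertBasis.coe_mkOfOrthogonalEqBot, inner_self_eq_norm_sq_to_K] at hsum
  have hsum' := hsum.mul_left (K : ℂ)
  have hfun : (fun i => (K : ℂ) * (inner ℂ (hf.toLp f) (v i) * inner ℂ (v i) (hf.toLp f))) =
      fun i => ((‖∫ x, f x * starRingEnd ℂ (e i x) ∂μ‖ ^ 2 : ℝ) : ℂ) := by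
    funext i
    rw [← inner_conj_symm, hinner, map_mul, hsc, Complex.ofReal_pow, ← Complex.mul_conj']
    linear_combination ((∫ x, f x * starRingEnd ℂ (e i x) ∂μ) *
      starRingEnd ℂ (∫ x, f x * starRingEnd ℂ (e i x) ∂μ)) * hsK
  have hval : (K : ℂ) * ((‖hf.toLp f‖ : ℝ) : ℂ) ^ 2 = ((K * ‖hf.toLp f‖ ^ 2 : ℝ) : ℂ) := by
    push_cast; rfl
  rw [hfun] at hsum'
  exact Complex.hasSum_ofReal.1 (hval ▸ hsum')

lemma sq_norm_toLp {f : α → ℂ} (hf : MemLp f 2 μ) : ‖hf.toLp f‖ ^ 2 = ∫ x, ‖f x‖ ^ 2 ∂μ := by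
  have h1 := inner_toLp_toLp hf hf
  rw [inner_self_eq_norm_sq_to_K] at h1
  simp_rw [Complex.mul_conj'] at h1
  have h2 : ∫ x, (‖f x‖ : ℂ) ^ 2 ∂μ = ((∫ x, ‖f x‖ ^ 2 ∂μ : ℝ) : ℂ) := by
    rw [← integral_complex_ofReal]
    push_cast; rfl
  rw [h2] at h1
  exact Complex.ofReal_injective (by rw [Complex.ofReal_pow]; exact h1)

lemma tsum_sq_enorm_integral_mul_conj {ι : Type*} [DecidableEq ι] {e : ι → α → ℂ}
    (he : ∀ i, MemLp (e i) 2 μ) {K : ℝ} (hK : 0 < K)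
    (horth : ∀ i j, ∫ x, e i x * starRingEnd ℂ (e j x) ∂μ = if i = j then (K : ℂ) else 0)
    (hcompl : ∀ f : α → ℂ, MemLp f 2 μ → (∀ i, ∫ x, f x * starRingEnd ℂ (e i x) ∂μ = 0) →
      f =ᵐ[μ] 0)
    {f : α → ℂ} (hf : MemLp f 2 μ) :
    ∑' i, ‖∫ x, f x * starRingEnd ℂ (e i x) ∂μ‖ₑ ^ 2 = ENNReal.ofReal K * eLpNorm f 2 μ ^ 2 := by
  have h1 := hasSum_sq_norm_integral_mul_conj he hK horth hcompl hf
  have h2 := ENNReal.ofReal_tsum_of_nonneg (fun i => sq_nonneg _) h1.summable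
  rw [h1.tsum_eq, ENNReal.ofReal_mul hK.le, ENNReal.ofReal_pow (norm_nonneg _), ofReal_norm,
    Lp.enorm_toLp] at h2
  rw [h2]
  refine tsum_congr fun i => ?_
  rw [ENNReal.ofReal_pow (norm_nonneg _), ofReal_norm]

lemma sq_eLpNorm_two (f : α → ℂ) : eLpNorm f 2 μ ^ 2 = ∫⁻ x, ‖f x‖ₑ ^ 2 ∂μ := by
  rw [eLpNorm_eq_lintegral_rpow_enorm_toReal two_ne_zero ENNReal.ofNat_ne_top,
    ← ENNReal.rpow_natCast, ← ENNReal.rpow_mul]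
  simp

lemma eLpNorm_add_smul_le {u v : α → ℂ} (hu : AEStronglyMeasurable u μ)
    (hv : AEStronglyMeasurable v μ) (z : ℂ) :
    eLpNorm (u + z • v) 2 μ ≤ eLpNorm u 2 μ + ‖z‖ₑ * eLpNorm v 2 μ := by
  rw [← eLpNorm_const_smul]
  exact eLpNorm_add_le hu (hv.const_smul z) one_le_two

end General

lemma IsDigitSystem.memLp_seqChar (h : IsDigitSystem M D) (l : ℕ) {b : ℤ → Fin d → ℤ}
    (hb : IsDigitSeq D' b) :
    MemLp (fun x => seqChar M (digits M D x) b) 2 (volume.restrict (tile M D l)) := by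
  have := h.isFiniteMeasure_tile l
  exact MemLp.of_bound (h.aestronglyMeasurable_seqChar l hb) 1
    (ae_of_all _ fun x => (norm_seqChar _ _).le)

lemma IsDigitSystem.volume_real_pos (h : IsDigitSystem M D) :
    0 < volume.real (cylinder M D 0 0) :=
  ENNReal.toReal_pos h.volume_cylinder_zero_pos.ne' h.volume_cylinder_zero_lt_top.ne

/-- Parseval's identity for the Fourier coefficients of a function on a tile. -/
lemma IsDigitSystem.tsum_tileIndex (h : IsDigitSystem M D) (h' : IsDigitSystem Mᵀ D')
    (l : ℕ) {f : (Fin d → ℝ) → ℂ} (hf : MemLp f 2 (volume.restrict (tile M D l))) :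
    ∑' b : TileIndex D' l,
        ‖∫ x in tile M D l, f x * starRingEnd ℂ (seqChar M (digits M D x) b.1)‖ₑ ^ 2 =
      ENNReal.ofReal ((M.det.natAbs : ℝ) ^ l * volume.real (cylinder M D 0 0)) *
        eLpNorm f 2 (volume.restrict (tile M D l)) ^ 2 := by
  classical
  have := h.isFiniteMeasure_tile l
  have hm : (0 : ℝ) < M.det.natAbs := by exact_mod_cast Int.natAbs_pos.2 h.det_ne_zero
  refine tsum_sq_enorm_integral_mul_conj (fun b => h.memLp_seqChar l b.2.1)
    (mul_pos (pow_pos hm l) h.volume_real_pos) (fun b b' => ?_) (fun g hg hg0 => ?_) hf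
  · rw [h.integral_seqChar_mul_conj h' l b b']
  · exact h.ae_eq_zero_of_orthogonal h' l (hg.integrable one_le_two) hg0

/-! ### The truncated transforms -/

lemma IsDigitSystem.restrict_powImage_U (h : IsDigitSystem M D) (l : ℕ) :
    volume.restrict (powImage M l (U M D)) = volume.restrict (tile M D l) :=
  Measure.restrict_congr_set (h.powImage_U_ae_eq l)

lemma IsDigitSystem.restrict_X (h : IsDigitSystem M D) :
    volume.restrict (X M D) = volume.restrict (XPlus M D) :=
  Measure.restrict_congr_set h.X_ae_eq

lemma IsDigitSystem.volume_U (h : IsDigitSystem M D) :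
    volume (U M D) = volume (cylinder M D 0 0) := measure_congr h.U_ae_eq

lemma IsDigitSystem.volume_real_U_pos (h : IsDigitSystem M D) : 0 < volume.real (U M D) := by
  rw [Measure.real, h.volume_U]
  exact h.volume_real_pos

lemma tile_mono : Monotone (tile M D) := fun k l hkl =>
  cylinder_mono (by omega) fun _ _ => rfl

lemma tile_subset_XPlus (l : ℕ) : tile M D l ⊆ XPlus M D := fun _ ⟨b, hb, _⟩ => ⟨b, hb⟩

lemma IsDigitSystem.restrict_tile_le (h : IsDigitSystem M D) (l : ℕ) :
    volume.restrict (tile M D l) ≤ volume.restrict (X M D) := by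
  rw [h.restrict_X]
  exact Measure.restrict_mono (tile_subset_XPlus l) le_rfl

lemma IsDigitSystem.J_eq (h : IsDigitSystem M D) (l : ℕ) (f : (Fin d → ℝ) → ℂ) (ω : Fin d → ℝ) :
    J M D D' l f ω = (1 / (volume.real (U M D) : ℂ)) *
      ∫ x in tile M D l, f x * starRingEnd ℂ (chi M D D' x ω) := by
  rw [J, h.restrict_powImage_U]

lemma IsDigitSystem.integrable_mul_conj_chi (h : IsDigitSystem M D) (h' : IsDigitSystem Mᵀ D')
    (l : ℕ) {f : (Fin d → ℝ) → ℂ} (hf : MemLp f 2 (volume.restrict (X M D))) (ω : Fin d → ℝ) :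
    IntegrableOn (fun x => f x * starRingEnd ℂ (chi M D D' x ω)) (tile M D l) := by
  have := h.isFiniteMeasure_tile l
  exact h.integrable_mul_conj_seqChar l
    ((hf.mono_measure (h.restrict_tile_le l)).integrable one_le_two) (h'.isDigitSeq_digits ω)

/-- On the tile `M^l(U)` the characters depend only on the digits of `ω` of index at most `l`. -/
lemma IsDigitSystem.J_eq_of_digits_eq (h : IsDigitSystem M D) (l : ℕ) (f : (Fin d → ℝ) → ℂ)
    {ω : Fin d → ℝ} {b : ℤ → Fin d → ℤ} (hω : ∀ i ≤ (l : ℤ), digits Mᵀ D' ω i = b i) :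
    J M D D' l f ω = (1 / (volume.real (U M D) : ℂ)) *
      ∫ x in tile M D l, f x * starRingEnd ℂ (seqChar M (digits M D x) b) := by
  rw [h.J_eq]
  congr 1
  refine integral_congr_ae ?_
  filter_upwards [h.ae_digits_eq_zero_of_tile l] with x hx
  rw [chi_eq_seqChar, seqChar, seqChar]
  congr 6
  funext j
  rcases le_or_gt j (-(l : ℤ)) with hj | hj
  · rw [hx j hj]; simp [realVec_zero]
  · rw [hω _ (by omega)]

lemma IsDigitSystem.XPlus_eq_iUnion_cylinder (h : IsDigitSystem M D) (l : ℕ) :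
    XPlus M D = ⋃ b : TileIndex D l, cylinder M D l b.1 := by
  ext x
  simp only [Set.mem_iUnion]
  constructor
  · rintro ⟨a, ha⟩
    refine ⟨⟨trunc l a, h.isDigitSeq_trunc ha.isDigitSeq l, fun i hi => ?_⟩, a, ha,
      fun j hj => ?_⟩
    · exact if_neg (by omega)
    · exact (if_pos hj).symm
  · rintro ⟨b, a, ha, -⟩
    exact ⟨a, ha⟩

lemma IsDigitSystem.aedisjoint_cylinder (h : IsDigitSystem M D) (l : ℕ) :
    Pairwise (Function.onFun (AEDisjoint volume)
      fun b : TileIndex D l => cylinder M D l b.1) := by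
  intro b b' hbb
  rw [Function.onFun, AEDisjoint, measure_eq_zero_iff_ae_notMem]
  filter_upwards [h.ae_mem_cylinder_iff] with x hx hxb
  refine hbb (Subtype.ext (funext fun i => ?_))
  rcases le_or_gt i l with hi | hi
  · rw [← ((hx _ _).1 hxb.1).2 i hi, ((hx _ _).1 hxb.2).2 i hi]
  · rw [b.2.2 i hi, b'.2.2 i hi]

lemma IsDigitSystem.ae_cylinder_J_eq (h : IsDigitSystem M D) (h' : IsDigitSystem Mᵀ D') (l : ℕ)
    (f : (Fin d → ℝ) → ℂ) (b : TileIndex D' l) :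
    ∀ᵐ ω ∂volume.restrict (cylinder Mᵀ D' l b.1), J M D D' l f ω =
      (1 / (volume.real (U M D) : ℂ)) *
        ∫ x in tile M D l, f x * starRingEnd ℂ (seqChar M (digits M D x) b.1) := by
  rw [ae_restrict_iff' (h'.measurableSet_cylinder _ b.2.1)]
  filter_upwards [h'.ae_mem_cylinder_iff] with ω hω hωb
  exact h.J_eq_of_digits_eq l f ((hω _ _).1 hωb).2

lemma IsDigitSystem.aestronglyMeasurable_J (h : IsDigitSystem M D) (h' : IsDigitSystem Mᵀ D')
    (l : ℕ) (f : (Fin d → ℝ) → ℂ) :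
    AEStronglyMeasurable (J M D D' l f) (volume.restrict (X Mᵀ D')) := by
  rw [h'.restrict_X, h'.XPlus_eq_iUnion_cylinder l, aestronglyMeasurable_iUnion_iff]
  exact fun b => aestronglyMeasurable_const.congr
    (Filter.EventuallyEq.symm (h.ae_cylinder_J_eq h' l f b))

/-- The truncated transform is a multiple of an isometry: it is constant on the cylinder sets
`cylinder Mᵀ D' l b`, with values the Fourier coefficients with respect to a complete orthogonal
system. -/
lemma IsDigitSystem.eLpNorm_J (h : IsDigitSystem M D) (h' : IsDigitSystem Mᵀ D') (l : ℕ)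
    {f : (Fin d → ℝ) → ℂ} (hf : MemLp f 2 (volume.restrict (tile M D l))) :
    eLpNorm (J M D D' l f) 2 (volume.restrict (X Mᵀ D')) =
      ENNReal.ofReal √(volume.real (U Mᵀ D') / volume.real (U M D)) *
        eLpNorm f 2 (volume.restrict (tile M D l)) := by
  have hc := h.volume_real_U_pos
  have hc' := h'.volume_real_U_pos
  have hm : (0 : ℝ) < M.det.natAbs := by exact_mod_cast Int.natAbs_pos.2 h.det_ne_zero
  refine (ENNReal.pow_right_strictMono two_ne_zero).injective ?_
  rw [mul_pow, ← ENNReal.ofReal_pow (Real.sqrt_nonneg _), Real.sq_sqrt (div_pos hc' hc).le,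
    sq_eLpNorm_two, h'.restrict_X, h'.XPlus_eq_iUnion_cylinder l,
    lintegral_iUnion₀ (fun b => (h'.measurableSet_cylinder _ b.2.1).nullMeasurableSet)
      (h'.aedisjoint_cylinder l)]
  have hpiece : ∀ b : TileIndex D' l,
      ∫⁻ ω in cylinder Mᵀ D' l b.1, ‖J M D D' l f ω‖ₑ ^ 2 =
        ENNReal.ofReal ((volume.real (U M D))⁻¹ ^ 2 * ((M.det.natAbs : ℝ) ^ l)⁻¹ *
          volume.real (U Mᵀ D')) *
        ‖∫ x in tile M D l, f x * starRingEnd ℂ (seqChar M (digits M D x) b.1)‖ₑ ^ 2 := by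
    intro b
    have hvol : volume (cylinder Mᵀ D' l b.1) =
        ENNReal.ofReal (((M.det.natAbs : ℝ) ^ l)⁻¹ * volume.real (U Mᵀ D')) := by
      rw [← ENNReal.ofReal_toReal (h'.isCompact_cylinder l b.2.1).measure_lt_top.ne]
      congr 1
      have := h'.volume_real_cylinder l b.2.1
      rw [Matrix.det_transpose, zpow_neg, zpow_natCast] at this
      rw [measureReal_congr h'.U_ae_eq]
      exact this
    rw [lintegral_congr_ae ((h.ae_cylinder_J_eq h' l f b).mono fun ω hω => by rw [hω]),
      setLIntegral_const, hvol, enorm_mul, mul_pow]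
    have h1 : ‖(1 / (volume.real (U M D) : ℂ))‖ₑ ^ 2 =
        ENNReal.ofReal ((volume.real (U M D))⁻¹ ^ 2) := by
      rw [← ofReal_norm, ← ENNReal.ofReal_pow (norm_nonneg _)]
      congr 2
      rw [one_div, norm_inv, Complex.norm_real, Real.norm_of_nonneg hc.le]
    rw [h1, mul_assoc, mul_assoc, mul_comm (‖_‖ₑ ^ 2), ← mul_assoc,
      ← ENNReal.ofReal_mul (by positivity)]
  simp_rw [hpiece]
  rw [ENNReal.tsum_mul_left, h.tsum_tileIndex h' l hf, ← mul_assoc,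
    ← ENNReal.ofReal_mul (by positivity)]
  congr 2
  have : volume.real (cylinder M D 0 0) = volume.real (U M D) :=
    (measureReal_congr h.U_ae_eq).symm
  rw [this]
  have hml : (M.det.natAbs : ℝ) ^ l ≠ 0 := (pow_pos hm l).ne'
  field_simp

lemma IsDigitSystem.memLp_J (h : IsDigitSystem M D) (h' : IsDigitSystem Mᵀ D') (l : ℕ)
    {f : (Fin d → ℝ) → ℂ} (hf : MemLp f 2 (volume.restrict (X M D))) :
    MemLp (J M D D' l f) 2 (volume.restrict (X Mᵀ D')) := by
  have hft := hf.mono_measure (h.restrict_tile_le l)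
  refine ⟨h.aestronglyMeasurable_J h' l f, ?_⟩
  rw [h.eLpNorm_J h' l hft]
  exact ENNReal.mul_lt_top ENNReal.ofReal_lt_top hft.2

lemma IsDigitSystem.J_add_smul (h : IsDigitSystem M D) (h' : IsDigitSystem Mᵀ D') (l : ℕ)
    {f g : (Fin d → ℝ) → ℂ} (hf : MemLp f 2 (volume.restrict (X M D)))
    (hg : MemLp g 2 (volume.restrict (X M D))) (α : ℂ) (ω : Fin d → ℝ) :
    J M D D' l (f + α • g) ω = J M D D' l f ω + α * J M D D' l g ω := by
  rw [h.J_eq, h.J_eq, h.J_eq]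
  have h1 : (fun x => (f + α • g) x * starRingEnd ℂ (chi M D D' x ω)) = fun x =>
      f x * starRingEnd ℂ (chi M D D' x ω) + α * (g x * starRingEnd ℂ (chi M D D' x ω)) := by
    funext x
    simp only [Pi.add_apply, Pi.smul_apply, smul_eq_mul]
    ring
  rw [h1, integral_add (h.integrable_mul_conj_chi h' l hf ω)
    ((h.integrable_mul_conj_chi h' l hg ω).const_mul α), integral_const_mul]
  ring

lemma IsDigitSystem.memLp_indicator (h : IsDigitSystem M D) (k : ℕ) {f : (Fin d → ℝ) → ℂ}
    (hf : MemLp f 2 (volume.restrict (X M D))) :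
    MemLp ((tile M D k).indicator f) 2 (volume.restrict (X M D)) :=
  hf.indicator (h.measurableSet_tile k)

/-- The shorter truncations are transforms of restrictions. -/
lemma IsDigitSystem.J_indicator (h : IsDigitSystem M D) {k l : ℕ} (hkl : k ≤ l)
    (f : (Fin d → ℝ) → ℂ) (ω : Fin d → ℝ) :
    J M D D' l ((tile M D k).indicator f) ω = J M D D' k f ω := by
  rw [h.J_eq, h.J_eq]
  congr 1
  have h1 : (fun x => (tile M D k).indicator f x * starRingEnd ℂ (chi M D D' x ω)) =
      (tile M D k).indicator fun x => f x * starRingEnd ℂ (chi M D D' x ω) := by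
    funext x
    by_cases hx : x ∈ tile M D k <;> simp [hx]
  rw [h1, integral_indicator (h.measurableSet_tile k), Measure.restrict_restrict
    (h.measurableSet_tile k), Set.inter_eq_left.2 (tile_mono hkl)]

/-- The restrictions of `f` to the tiles converge to `f` in the mean. -/
lemma IsDigitSystem.tendsto_eLpNorm_sub_indicator (h : IsDigitSystem M D) {f : (Fin d → ℝ) → ℂ}
    (hf : MemLp f 2 (volume.restrict (X M D))) :
    Tendsto (fun k : ℕ => eLpNorm ((tile M D k).indicator f - f) 2 (volume.restrict (X M D)))
      atTop (𝓝 0) := by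
  have hsq : Tendsto (fun k : ℕ =>
      ∫⁻ x in X M D, ‖((tile M D k).indicator f - f) x‖ₑ ^ 2) atTop (𝓝 0) := by
    have h0 : (0 : ℝ≥0∞) = ∫⁻ _ in X M D, 0 := by simp
    rw [h0]
    refine tendsto_lintegral_of_dominated_convergence' (fun x => ‖f x‖ₑ ^ 2) (fun k => ?_)
      (fun k => ae_of_all _ fun x => ?_) ?_ ?_
    · exact ((h.memLp_indicator k hf).1.sub hf.1).enorm.pow_const 2
    · by_cases hx : x ∈ tile M D k <;> simp [hx]
    · rw [← sq_eLpNorm_two]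
      exact ENNReal.pow_ne_top hf.2.ne
    · rw [h.restrict_X]
      filter_upwards [ae_restrict_mem h.measurableSet_XPlus] with x hx
      rw [XPlus_eq_iUnion] at hx
      obtain ⟨k₀, hk₀⟩ := Set.mem_iUnion.1 hx
      refine tendsto_const_nhds.congr' ?_
      filter_upwards [eventually_ge_atTop k₀] with k hk
      have hxk : x ∈ tile M D k := tile_mono hk hk₀
      simp [hxk]
  have hrt := hsq.ennrpow_const (1 / 2)
  have hz : (0 : ℝ≥0∞) ^ (1 / 2 : ℝ) = 0 := by simp
  rw [hz] at hrt
  refine hrt.congr fun k => ?_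
  rw [← sq_eLpNorm_two ((tile M D k).indicator f - f), ← ENNReal.rpow_natCast,
    ← ENNReal.rpow_mul]
  simp

lemma IsDigitSystem.eLpNorm_J_sub_le (h : IsDigitSystem M D) (h' : IsDigitSystem Mᵀ D') {k l : ℕ}
    (hkl : k ≤ l) {f : (Fin d → ℝ) → ℂ} (hf : MemLp f 2 (volume.restrict (X M D))) :
    eLpNorm (J M D D' k f - J M D D' l f) 2 (volume.restrict (X Mᵀ D')) ≤
      ENNReal.ofReal √(volume.real (U Mᵀ D') / volume.real (U M D)) *
        eLpNorm ((tile M D k).indicator f - f) 2 (volume.restrict (X M D)) := by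
  have h1 : J M D D' k f - J M D D' l f = J M D D' l ((tile M D k).indicator f - f) := by
    funext ω
    have h2 : (tile M D k).indicator f - f = (tile M D k).indicator f + (-1 : ℂ) • f := by
      rw [neg_one_smul, sub_eq_add_neg]
    rw [h2, h.J_add_smul h' l (h.memLp_indicator k hf) hf, h.J_indicator hkl, Pi.sub_apply]
    ring
  have hmem := (h.memLp_indicator k hf).sub hf
  rw [h1, h.eLpNorm_J h' l (hmem.mono_measure (h.restrict_tile_le l))]
  exact mul_le_mul' le_rfl
    (eLpNorm_mono_measure ((tile M D k).indicator f - f) (h.restrict_tile_le l))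

/-- The truncated transforms form a Cauchy sequence, and hence converge. -/
lemma IsDigitSystem.exists_isFourierTransform (h : IsDigitSystem M D) (h' : IsDigitSystem Mᵀ D')
    {f : (Fin d → ℝ) → ℂ} (hf : MemLp f 2 (volume.restrict (X M D))) :
    ∃ F, IsFourierTransform M D D' f F := by
  have hJ := fun l => h.memLp_J h' l hf
  set κ := ENNReal.ofReal √(volume.real (U Mᵀ D') / volume.real (U M D)) with hκ
  have hlim : Tendsto (fun k : ℕ => 2 * (κ * eLpNorm ((tile M D k).indicator f - f) 2
      (volume.restrict (X M D)))) atTop (𝓝 0) := by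
    have h1 := ENNReal.Tendsto.const_mul (h.tendsto_eLpNorm_sub_indicator hf)
      (Or.inr (ENNReal.ofReal_ne_top : κ ≠ ∞))
    have h2 := ENNReal.Tendsto.const_mul h1 (Or.inr (ENNReal.ofNat_ne_top : (2 : ℝ≥0∞) ≠ ∞))
    simpa only [mul_zero] using h2
  have hcau : CauchySeq fun l => (hJ l).toLp (J M D D' l f) := by
    refine EMetric.cauchySeq_iff_le_tendsto_0.2 ⟨_, fun n m N hn hm => ?_, hlim⟩
    have h1 : ∀ n, N ≤ n → edist ((hJ N).toLp (J M D D' N f)) ((hJ n).toLp (J M D D' n f)) ≤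
        κ * eLpNorm ((tile M D N).indicator f - f) 2 (volume.restrict (X M D)) := fun n hn => by
      rw [Lp.edist_toLp_toLp]
      exact h.eLpNorm_J_sub_le h' hn hf
    refine (edist_triangle_left _ _ ((hJ N).toLp (J M D D' N f))).trans ?_
    rw [two_mul]
    exact add_le_add (h1 n hn) (h1 m hm)
  obtain ⟨F, hF⟩ := cauchySeq_tendsto_of_complete hcau
  refine ⟨F, Lp.memLp F, hJ, ?_⟩
  have h1 := (Lp.tendsto_Lp_iff_tendsto_eLpNorm'' _ hJ F (Lp.memLp F)).1
    (by rwa [Lp.toLp_coeFn])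
  exact h1

/-! ### Plancherel and Parseval -/

lemma IsFourierTransform.add_smul (h : IsDigitSystem M D) (h' : IsDigitSystem Mᵀ D')
    {f g F G : (Fin d → ℝ) → ℂ} (hf : MemLp f 2 (volume.restrict (X M D)))
    (hg : MemLp g 2 (volume.restrict (X M D))) (hF : IsFourierTransform M D D' f F)
    (hG : IsFourierTransform M D D' g G) (α : ℂ) :
    IsFourierTransform M D D' (f + α • g) (F + α • G) := by
  refine ⟨hF.1.add (hG.1.const_smul α), fun l => h.memLp_J h' l (hf.add (hg.const_smul α)), ?_⟩
  have h1 : Tendsto (fun l : ℕ =>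
      eLpNorm (fun ω => J M D D' l f ω - F ω) 2 (volume.restrict (X Mᵀ D')) + ‖α‖ₑ *
      eLpNorm (fun ω => J M D D' l g ω - G ω) 2 (volume.restrict (X Mᵀ D'))) atTop (𝓝 0) := by
    have := hF.2.2.add (ENNReal.Tendsto.const_mul hG.2.2
      (Or.inr (enorm_ne_top : ‖α‖ₑ ≠ ∞)))
    simpa using this
  refine tendsto_of_tendsto_of_tendsto_of_le_of_le tendsto_const_nhds h1 (fun _ => zero_le)
    fun l => ?_
  have h2 : (fun ω => J M D D' l (f + α • g) ω - (F + α • G) ω) =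
      (fun ω => J M D D' l f ω - F ω) + α • fun ω => J M D D' l g ω - G ω := by
    funext ω
    rw [h.J_add_smul h' l hf hg]
    simp only [Pi.add_apply, Pi.smul_apply, smul_eq_mul]
    ring
  dsimp only
  rw [h2]
  exact eLpNorm_add_smul_le ((hF.2.1 l).1.sub hF.1.1) ((hG.2.1 l).1.sub hG.1.1) α

lemma IsFourierTransform.norm_toLp (h : IsDigitSystem M D) (h' : IsDigitSystem Mᵀ D')
    {f F : (Fin d → ℝ) → ℂ} (hf : MemLp f 2 (volume.restrict (X M D)))
    (hF : IsFourierTransform M D D' f F) :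
    ‖hF.1.toLp F‖ = √(volume.real (U Mᵀ D') / volume.real (U M D)) * ‖hf.toLp f‖ := by
  have hind := fun k => h.memLp_indicator k hf
  have h1 : Tendsto (fun l => ‖(hF.2.1 l).toLp (J M D D' l f)‖) atTop (𝓝 ‖hF.1.toLp F‖) :=
    ((Lp.tendsto_Lp_iff_tendsto_eLpNorm'' _ hF.2.1 F hF.1).2 hF.2.2).norm
  have h2 : Tendsto (fun l => ‖(hind l).toLp ((tile M D l).indicator f)‖) atTop
      (𝓝 ‖hf.toLp f‖) :=
    ((Lp.tendsto_Lp_iff_tendsto_eLpNorm'' _ hind f hf).2 (h.tendsto_eLpNorm_sub_indicator hf)).norm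
  refine tendsto_nhds_unique h1 ((h2.const_mul _).congr fun l => ?_)
  rw [Lp.norm_toLp, Lp.norm_toLp, h.eLpNorm_J h' l (hf.mono_measure (h.restrict_tile_le l)),
    ENNReal.toReal_mul, ENNReal.toReal_ofReal (Real.sqrt_nonneg _),
    eLpNorm_indicator_eq_eLpNorm_restrict (h.measurableSet_tile l),
    Measure.restrict_restrict (h.measurableSet_tile l)]
  congr 3
  refine (Measure.restrict_congr_set ?_).symm
  filter_upwards [h.ae_mem_X_iff] with x hx
  change (x ∈ tile M D l) = (x ∈ tile M D l ∩ X M D)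
  exact Eq.symm (propext (and_iff_left_of_imp fun hxt => hx.2 (tile_subset_XPlus l hxt)))

lemma IsFourierTransform.inner_toLp (h : IsDigitSystem M D) (h' : IsDigitSystem Mᵀ D')
    {f g F G : (Fin d → ℝ) → ℂ} (hf : MemLp f 2 (volume.restrict (X M D)))
    (hg : MemLp g 2 (volume.restrict (X M D))) (hF : IsFourierTransform M D D' f F)
    (hG : IsFourierTransform M D D' g G) :
    inner ℂ (hG.1.toLp G) (hF.1.toLp F) =
      ((volume.real (U Mᵀ D') / volume.real (U M D) : ℝ) : ℂ) *
        inner ℂ (hg.toLp g) (hf.toLp f) := by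
  have hpos : 0 ≤ volume.real (U Mᵀ D') / volume.real (U M D) := by positivity
  -- Apply the norm identity to `g + α f`, and polarize.
  have key : ∀ α : ℂ, ((‖hG.1.toLp G + α • hF.1.toLp F‖ : ℝ) : ℂ) ^ 2 =
      ((volume.real (U Mᵀ D') / volume.real (U M D) : ℝ) : ℂ) *
        ((‖hg.toLp g + α • hf.toLp f‖ : ℝ) : ℂ) ^ 2 := by
    intro α
    have h1 := IsFourierTransform.norm_toLp h h' (hg.add (hf.const_smul α))
      (IsFourierTransform.add_smul h h' hg hf hG hF α)
    have h2 : ‖hG.1.toLp G + α • hF.1.toLp F‖ =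
        √(volume.real (U Mᵀ D') / volume.real (U M D)) * ‖hg.toLp g + α • hf.toLp f‖ := h1
    rw [h2, ← Complex.ofReal_pow, ← Complex.ofReal_pow, ← Complex.ofReal_mul, mul_pow,
      Real.sq_sqrt hpos]
  have k1 := key 1
  have k2 := key (-1)
  have k3 := key (-Complex.I)
  have k4 := key Complex.I
  simp only [one_smul, neg_smul, ← sub_eq_add_neg] at k1 k2 k3 k4
  rw [inner_eq_sum_norm_sq_div_four (𝕜 := ℂ), inner_eq_sum_norm_sq_div_four (𝕜 := ℂ)]
  simp only [RCLike.I_to_complex, Complex.coe_algebraMap]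
  rw [k1, k2, k3, k4]
  ring

/-- On integrable functions the truncated transforms converge pointwise to the Fourier integral. -/
lemma IsDigitSystem.tendsto_J (h : IsDigitSystem M D) (h' : IsDigitSystem Mᵀ D')
    {f : (Fin d → ℝ) → ℂ} (hf1 : IntegrableOn f (X M D)) (ω : Fin d → ℝ) :
    Tendsto (fun l => J M D D' l f ω) atTop (𝓝 (fourierIntegral M D D' f ω)) := by
  simp_rw [h.J_eq]
  unfold fourierIntegral
  refine Tendsto.const_mul _ ?_
  have hX : XPlus M D = ⋃ l, tile M D l := XPlus_eq_iUnion
  rw [IntegrableOn, h.restrict_X, hX] at hf1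
  rw [h.restrict_X, hX]
  refine tendsto_setIntegral_of_monotone h.measurableSet_tile tile_mono ?_
  refine hf1.mul_bdd (c := 1) ?_ (ae_of_all _ fun x => ?_)
  · rw [aestronglyMeasurable_iUnion_iff]
    exact fun l => Complex.continuous_conj.comp_aestronglyMeasurable
      (h.aestronglyMeasurable_seqChar l (h'.isDigitSeq_digits ω))
  · rw [RCLike.norm_conj, norm_chi]

lemma IsFourierTransform.ae_eq_fourierIntegral (h : IsDigitSystem M D) (h' : IsDigitSystem Mᵀ D')
    {f F : (Fin d → ℝ) → ℂ} (hf1 : IntegrableOn f (X M D))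
    (hF : IsFourierTransform M D D' f F) :
    F =ᵐ[volume.restrict (X Mᵀ D')] fourierIntegral M D D' f := by
  have hmeas : TendstoInMeasure (volume.restrict (X Mᵀ D')) (fun l => J M D D' l f) atTop F :=
    tendstoInMeasure_of_tendsto_eLpNorm two_ne_zero (fun l => (hF.2.1 l).1) hF.1.1 hF.2.2
  obtain ⟨φ, hφ, hlim⟩ := hmeas.exists_seq_tendsto_ae
  filter_upwards [hlim] with ω hω
  exact tendsto_nhds_unique hω ((h.tendsto_J h' hf1 ω).comp hφ.tendsto_atTop)

end MPositive

theorem mainTheorem1 {d : ℕ} (M : Matrix (Fin d) (Fin d) ℤ) (hm : 2 ≤ M.det.natAbs)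
    (hM : MPositive.IsDilation M) (D D' : Finset (Fin d → ℤ))
    (hD : MPositive.IsDigitSet M D) (hD' : MPositive.IsDigitSet Mᵀ D') :
    -- the normalizing constants are positive and finite
    (0 < volume (MPositive.U M D) ∧ volume (MPositive.U M D) < ∞) ∧
    (0 < volume (MPositive.U Mᵀ D') ∧ volume (MPositive.U Mᵀ D') < ∞) ∧
    -- the truncated transforms are defined, and converge in `L²(X*)` to the Fourier transform of `f`
    (∀ f : (Fin d → ℝ) → ℂ, MemLp f 2 (volume.restrict (MPositive.X M D)) →
      (∀ l : ℕ, ∀ ω ∈ MPositive.X Mᵀ D',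
        IntegrableOn (fun x => f x * starRingEnd ℂ (MPositive.chi M D D' x ω))
          (MPositive.powImage M l (MPositive.U M D))) ∧
      ∃ F : (Fin d → ℝ) → ℂ, MPositive.IsFourierTransform M D D' f F) ∧
    -- on `L¹(X) ∩ L²(X)` it is given by the Fourier integral
    (∀ f F : (Fin d → ℝ) → ℂ, MemLp f 2 (volume.restrict (MPositive.X M D)) →
      IntegrableOn f (MPositive.X M D) → MPositive.IsFourierTransform M D D' f F →
      F =ᵐ[volume.restrict (MPositive.X Mᵀ D')] MPositive.fourierIntegral M D D' f) ∧
    -- Plancherel identity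
    (∀ f F : (Fin d → ℝ) → ℂ, MemLp f 2 (volume.restrict (MPositive.X M D)) →
      MPositive.IsFourierTransform M D D' f F →
      (1 / volume.real (MPositive.U M D)) * ∫ x in MPositive.X M D, ‖f x‖ ^ 2 =
        (1 / volume.real (MPositive.U Mᵀ D')) * ∫ ω in MPositive.X Mᵀ D', ‖F ω‖ ^ 2) ∧
    -- Parseval identity
    (∀ f g F G : (Fin d → ℝ) → ℂ, MemLp f 2 (volume.restrict (MPositive.X M D)) →
      MemLp g 2 (volume.restrict (MPositive.X M D)) →
      MPositive.IsFourierTransform M D D' f F → MPositive.IsFourierTransform M D D' g G →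
      (1 / (volume.real (MPositive.U M D) : ℂ)) *
          ∫ x in MPositive.X M D, f x * starRingEnd ℂ (g x) =
        (1 / (volume.real (MPositive.U Mᵀ D') : ℂ)) *
          ∫ ω in MPositive.X Mᵀ D', F ω * starRingEnd ℂ (G ω)) := by
  have h : MPositive.IsDigitSystem M D := ⟨hm, hM, hD⟩
  have h' : MPositive.IsDigitSystem Mᵀ D' :=
    ⟨by rwa [Matrix.det_transpose], hM.transpose, hD'⟩
  have hc := h.volume_real_U_pos
  have hc' := h'.volume_real_U_pos
  refine ⟨?_, ?_, fun f hf => ⟨fun l ω _ => ?_, h.exists_isFourierTransform h' hf⟩,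
    fun f F _ hf1 hF => hF.ae_eq_fourierIntegral h h' hf1, fun f F hf hF => ?_,
    fun f g F G hf hg hF hG => ?_⟩
  · rw [h.volume_U]
    exact ⟨h.volume_cylinder_zero_pos, h.volume_cylinder_zero_lt_top⟩
  · rw [h'.volume_U]
    exact ⟨h'.volume_cylinder_zero_pos, h'.volume_cylinder_zero_lt_top⟩
  · rw [IntegrableOn, h.restrict_powImage_U]
    exact h.integrable_mul_conj_chi h' l hf ω
  · rw [← MPositive.sq_norm_toLp hf, ← MPositive.sq_norm_toLp hF.1, hF.norm_toLp h h' hf, mul_pow,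
      Real.sq_sqrt (div_pos hc' hc).le]
    field_simp
  · rw [← MPositive.inner_toLp_toLp hf hg, ← MPositive.inner_toLp_toLp hF.1 hG.1,
      hF.inner_toLp h h' hf hg hG]
    have h1 : (volume.real (MPositive.U M D) : ℂ) ≠ 0 := by exact_mod_cast hc.ne'
    have h2 : (volume.real (MPositive.U Mᵀ D') : ℂ) ≠ 0 := by exact_mod_cast hc'.ne'
    push_cast
    field_simp
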